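/- **Setting.** Let $l,m,n$ be natural numbers and let $F$ be a field of characteristic $0$ with commuting derivations $\partial=(\partial^1,\dots,\partial^m)^t$ that are linearly independent over $F$. Assume that $(F,\partial)$ is differentially closed: every finite system of differential equations and an inequation $q\neq0$ over $F$ that is solvable in a differential field extension is solvable in $F$. Let $C=\{a\in F:\partial^1a=\dots=\partial^ma=0\}$. For a system $\delta$ of $m$ commuting derivations put $GL^{\delta}(m,F)=\{g\in GL(m,F):\delta^i g^j_k=\delta^j g^i_k\ \text{for all } i,j,k\}$ (upper index: row), and let $\mathbf B=\{g^{-1}\partial: g\in GL^{\partial}(m,F)\}$. A differential polynomial $p$ over $C$ is evaluated at $\delta\in\mathbf B$ and a point $v$ by letting $\delta$ act as the derivations; write $p^\delta\langle v\rangle$. For a family $S=(S_\delta)_{\delta\in\mathbf B}$ of subsets of an affine space, $C\{S\}$ is the ring of differential polynomials over $C$ modulo those $p$ with $p^\delta\langle v\rangle=0$ for all $\delta\in\mathbf B$, $v\in S_\delta$, and $C\langle S\rangle$ is its total ring of fractions, with the induced derivations $\partial$. An element $f\in C\langle S\rangle$ is defined at $(\delta,v)$ if $f=r/s$ (in the sense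 $f\cdot s=r$) with $s^\delta\langle v\rangle$ invertible, and then $f^\delta\langle v\rangle=r^\delta\langle v\rangle/s^\delta\langle v\rangle$; the same definition is used for points with coordinates in a ring with derivations that contains $C$. Let $W=(W_\delta)_{\delta\in\mathbf B}$, where each $W_\delta\subseteq F^l$ is closed and irreducible in the $\delta$-differential Zariski topology (closed sets: zero sets of $\delta$-differential polynomials over $F$). Let $\tau$ be an algebraic representation of the groupoid on $W$: for $\delta\in\mathbf B$, $(h,g)\in GL(n,F)\times GL^\delta(m,F)$, $v\in W_\delta$ an element $\tau^\delta\langle h,g;v\rangle\in W_{g^{-1}\delta}$ is given, such that $\tau^\delta\langle 1,1;v\rangle=v$, $$\tau^{g^{-1}\delta}\langle h_1,g_1;\tau^\delta\langle h,g;v\rangle\rangle=\tau^\delta\langle hh_1,gg_1;v\rangle\qquad(h_1\in GL(n,F),\ g_1\in GL^{g^{-1}\delta}(m,F)),$$ and each component of $\tau$ is an everywhere defined differential rational function over $C$ in $(h,g,v)$ on the family $(GL(n,F)\times GL^\delta(m,F)\times W_\delta)_\delta$. Let $W_0=(W_{0\delta})_\delta$ with $W_{0\delta}\subseteq W_\delta$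 dense, and invariant: $\tau^\delta\langle h,g;v\rangle\in W_{0,g^{-1}\delta}$ for $v\in W_{0\delta}$. Let $P^\delta\langle v\rangle=(P_0^\delta\langle v\rangle,P_1^\delta\langle v\rangle)\in GL(n,F)\times GL^\delta(m,F)$, for $v\in W_{0\delta}$, be given such that $$P_0^{g^{-1}\delta}\langle\tau^\delta\langle h,g;v\rangle\rangle=h^{-1}P_0^\delta\langle v\rangle,\qquad P_1^{g^{-1}\delta}\langle\tau^\delta\langle h,g;v\rangle\rangle=g^{-1}P_1^\delta\langle v\rangle,$$ the entries of $P_0,P_1$ being values of elements of $C\langle W\rangle$ that are defined on $W_0$; these elements form matrices $P_0^\partial\langle\mathbf x\rangle,P_1^\partial\langle\mathbf x\rangle$ over $C\langle W\rangle$, where $\mathbf x$ is the vector of coordinate functions. Let $C\langle W_e;\partial\rangle^G=C\langle W\rangle^G$ be the set of the $f\in C\langle W\rangle$ with $f^{g^{-1}\delta}\langle\tau^\delta\langle h,g;v\rangle\rangle=f^\delta\langle v\rangle$ for all $\delta\in\mathbf B$, $(h,g)\in GL(n,F)\times GL^\delta(m,F)$, $v\in W_\delta$ for which both sides are defined. **Theorem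 2.4.** Under these hypotheses $C\langle W\rangle$ is a field, $P_1^\partial\langle\mathbf x\rangle$ is invertible over it, and the members of $\delta=P_1^\partial\langle\mathbf x\rangle^{-1}\partial$ commute. The set $C\langle W_e;\partial\rangle^G$ is closed under $\delta^1,\dots,\delta^m$; the element $\tau^\partial\langle P^\partial\langle\mathbf x\rangle;\mathbf x\rangle\in C\langle W\rangle^l$ is defined, and $C\langle W_e;\partial\rangle^G$ is the $\delta$-differential subfield of $C\langle W\rangle$ generated over $C$ by its components: $$C\langle W_e;\partial\rangle^G=C\langle\tau^\partial\langle P^\partial\langle\mathbf x\rangle;\mathbf x\rangle;\delta\rangle .$$ -/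

import Mathlib

open scoped Matrix MatrixGroups

universe u

noncomputable section

namespace DiffInv

/-! ### Systems of derivations, jets and differential polynomials -/

/-- The members of the system `D` commute with each other. -/
def Commuting {A : Type*} [CommRing A] {m : ℕ} (D : Fin m → Derivation ℤ A A) : Prop :=
  ∀ i j a, D i (D j a) = D j (D i a)

/-- The operator `(D 0) ^ (α 0) * (D 1) ^ (α 1) * ⋯` attached to a multi-index `α`. -/
def jetOp {A : Type*} [CommRing A] {m : ℕ} (D : Fin m → Derivation ℤ A A) (α : Fin m → ℕ) :
    Module.End ℤ A :=
  ((List.finRange m).map fun i => ((D i : A →ₗ[ℤ] A) : Module.End ℤ A) ^ α i).prod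

/-- Differential polynomials over `R` in the unknowns `x k`, `k : ι`, for `m` commuting
derivations: polynomials in the indeterminates `(k, α)`, which stand for the
derivatives `∂ ^ α (x k)`. -/
abbrev DPoly (R : Type*) [CommRing R] (m : ℕ) (ι : Type*) : Type _ :=
  MvPolynomial (ι × (Fin m → ℕ)) R

/-- The value at the point `z` of a differential polynomial, the derivations being
interpreted by the system `D`. -/
def evalD {R A : Type*} [CommRing R] [CommRing A] [Algebra R A] {m : ℕ} {ι : Type*}
    (D : Fin m → Derivation ℤ A A) (z : ι → A) : DPoly R m ι →ₐ[R] A :=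
  MvPolynomial.aeval fun kα : ι × (Fin m → ℕ) => jetOp D kα.2 (z kα.1)

/-- The formal `i`-th derivation of the ring of differential polynomials with constant
coefficients: it sends `∂ ^ α (x k)` to `∂ ^ (α + e i) (x k)` and kills the coefficients. -/
def formalD (R : Type*) [CommRing R] {m : ℕ} (ι : Type*) (i : Fin m) :
    Derivation R (DPoly R m ι) (DPoly R m ι) :=
  MvPolynomial.mkDerivation R fun kα : ι × (Fin m → ℕ) =>
    MvPolynomial.X (kα.1, kα.2 + Pi.single i 1)

/-- The system `M D`, where `D` is regarded as a column. -/
def combo {A : Type*} [CommRing A] {m : ℕ} (M : Matrix (Fin m) (Fin m) A)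
    (D : Fin m → Derivation ℤ A A) : Fin m → Derivation ℤ A A :=
  fun i => ∑ j, M i j • D j

/-! ### Differential fields -/

section Field

variable {F : Type u} [Field F] {m : ℕ}

/-- The field of constants of `(F, ∂)`. -/
def constants (d : Fin m → Derivation ℤ F F) : Subfield F where
  carrier := {a | ∀ i, d i a = 0}
  mul_mem' := by
    intro a b ha hb i
    simp [Derivation.leibniz, ha i, hb i]
  one_mem' := by intro i; simp
  add_mem' := by
    intro a b ha hb i
    simp [ha i, hb i]
  zero_mem' := by intro i; simp
  neg_mem' := by
    intro a ha i
    simp [ha i]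
  inv_mem' := by
    intro a ha i
    simp [Derivation.leibniz_inv, ha i]

/-- `(F, ∂)` is differentially closed: each finite system of differential equations
`p = 0`, `p ∈ E`, and an inequation `q ≠ 0` in finitely many unknowns over `F` that has a
solution in some differential field extension of `(F, ∂)` has a solution in `F`. -/
def IsDiffClosed (d : Fin m → Derivation ℤ F F) : Prop :=
  ∀ (k : ℕ) (E : Finset (DPoly F m (Fin k))) (q : DPoly F m (Fin k)),
    (∃ (L : Type u) (_ : Field L) (_ : Algebra F L) (D : Fin m → Derivation ℤ L L),
      Commuting D ∧ (∀ i a, D i (algebraMap F L a) = algebraMap F L (d i a)) ∧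
      ∃ z : Fin k → L, (∀ p ∈ E, evalD D z p = 0) ∧ evalD D z q ≠ 0) →
    ∃ z : Fin k → F, (∀ p ∈ E, evalD d z p = 0) ∧ evalD d z q ≠ 0

/-- The common zeros of a set of differential polynomials with coefficients in `F`. -/
def zeros (d : Fin m → Derivation ℤ F F) {ι : Type*} (E : Set (DPoly F m ι)) : Set (ι → F) :=
  {z | ∀ p ∈ E, evalD d z p = 0}

/-- The differential Zariski topology of `(F, ∂)`: the closed sets are the sets of
common zeros of differential polynomials with coefficients in `F`. -/
@[reducible]
def kolchin (d : Fin m → Derivation ℤ F F) (ι : Type*) : TopologicalSpace (ι → F) :=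
  TopologicalSpace.ofClosed (Set.range fun E : Set (DPoly F m ι) => zeros d E)
    ⟨Set.univ, by
      ext z
      simp only [zeros, Set.mem_ofPred_eq, Set.mem_empty_iff_false, iff_false, not_forall]
      exact ⟨1, Set.mem_univ _, by simp⟩⟩
    (by
      intro S hS
      refine ⟨{p | ∃ E, zeros d E ∈ S ∧ p ∈ E}, ?_⟩
      ext z
      simp only [zeros, Set.mem_ofPred_eq, Set.mem_sInter]
      constructor
      · intro h Z hZ
        obtain ⟨E, rfl⟩ := hS hZ
        exact fun p hp => h p ⟨E, hZ, hp⟩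
      · rintro h p ⟨E, hE, hp⟩
        exact h _ hE p hp)
    (by
      rintro _ ⟨E, rfl⟩ _ ⟨E₂, rfl⟩
      refine ⟨{r | ∃ p ∈ E, ∃ q ∈ E₂, r = p * q}, ?_⟩
      ext z
      simp only [zeros, Set.mem_ofPred_eq, Set.mem_union]
      constructor
      · intro h
        by_contra! hc
        obtain ⟨⟨p, hp, hpz⟩, q, hq, hqz⟩ := hc
        have := h _ ⟨p, hp, q, hq, rfl⟩
        rw [map_mul] at this
        exact (mul_ne_zero hpz hqz) this
      · rintro (h | h) _ ⟨p, hp, q, hq, rfl⟩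
        · rw [map_mul, h p hp, zero_mul]
        · rw [map_mul, h q hq, mul_zero])

/-- `GL^∂(m, F)`: the invertible matrices `g` (first index: row) with
`∂ i (g j k) = ∂ j (g i k)`. -/
def intGL (d : Fin m → Derivation ℤ F F) : Set (GL (Fin m) F) :=
  {g | ∀ i j k, d i (g j k) = d j (g i k)}

/-- The system `g⁻¹ ∂`. -/
def act (g : GL (Fin m) F) (d : Fin m → Derivation ℤ F F) : Fin m → Derivation ℤ F F :=
  combo ((g⁻¹ : GL (Fin m) F) : Matrix (Fin m) (Fin m) F) d

/-- The base `𝐁` of the groupoid: all systems `g⁻¹ ∂` with `g ∈ GL^∂(m, F)`. -/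
def base (d : Fin m → Derivation ℤ F F) : Set (Fin m → Derivation ℤ F F) :=
  {δ | ∃ g ∈ intGL d, δ = act g d}

theorem combo_apply {A : Type*} [CommRing A] (M : Matrix (Fin m) (Fin m) A)
    (D : Fin m → Derivation ℤ A A) (i : Fin m) (x : A) :
    combo M D i x = ∑ j, M i j * D j x := by
  have h : ∀ s : Finset (Fin m), (∑ j ∈ s, M i j • D j) x = ∑ j ∈ s, M i j * D j x := by
    intro s
    induction s using Finset.induction_on with
    | empty => simp
    | insert a s ha ih => simp [Finset.sum_insert ha, ih]
  exact h _

theorem sum_act (g : GL (Fin m) F) (d : Fin m → Derivation ℤ F F) (i : Fin m) (x : F) :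
    d i x = ∑ j, g i j * act g d j x := by
  have h : (g : Matrix (Fin m) (Fin m) F) *ᵥ
      (((g⁻¹ : GL (Fin m) F) : Matrix (Fin m) (Fin m) F) *ᵥ fun j => d j x) =
      fun j => d j x := by
    rw [Matrix.mulVec_mulVec, ← Units.val_mul, mul_inv_cancel, Units.val_one,
      Matrix.one_mulVec]
  have h2 := congrFun h i
  simp only [Matrix.mulVec, dotProduct] at h2
  simp only [act, combo_apply]
  exact h2.symm

theorem commuting_act {d : Fin m → Derivation ℤ F F} (hd : Commuting d) {g : GL (Fin m) F}
    (hg : g ∈ intGL d) : Commuting (act g d) := by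
  intro p q x
  let G : Matrix (Fin m) (Fin m) F := g.val
  have hG : G = g.val := rfl
  let E : Matrix (Fin m) (Fin m) F :=
    Matrix.of fun s k => act g d s (act g d k x) - act g d k (act g d s x)
  have key : ∀ a b, d a (d b x) = ∑ k, d a (G b k) * act g d k x +
      ∑ k, ∑ s, G a s * G b k * act g d s (act g d k x) := by
    intro a b
    rw [sum_act g d b x, map_sum, ← Finset.sum_add_distrib]
    refine Finset.sum_congr rfl fun k _ => ?_
    rw [Derivation.leibniz, sum_act g d a (act g d k x), smul_eq_mul, smul_eq_mul, add_comm,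
      Finset.mul_sum]
    congr 1
    · ring
    · refine Finset.sum_congr rfl fun s _ => ?_
      rw [hG]; ring
  have hE : G * E * Gᵀ = 0 := by
    ext a b
    have h1 := key a b
    have h2 := key b a
    rw [hd a b x, h2] at h1
    have h3 : ∑ k, d b (G a k) * act g d k x = ∑ k, d a (G b k) * act g d k x :=
      Finset.sum_congr rfl fun k _ => by rw [hG, hg b a k]
    rw [h3, add_right_inj] at h1
    have h4 : ∑ k, ∑ s, G b s * G a k * act g d s (act g d k x) =
        ∑ k, ∑ s, G a s * G b k * act g d k (act g d s x) := by
      rw [Finset.sum_comm]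
      exact Finset.sum_congr rfl fun k _ => Finset.sum_congr rfl fun s _ => by ring
    rw [h4] at h1
    simp only [Matrix.mul_apply, Matrix.transpose_apply, Matrix.zero_apply, E, Matrix.of_apply]
    rw [← sub_eq_zero.2 h1.symm, ← Finset.sum_sub_distrib]
    refine Finset.sum_congr rfl fun k _ => ?_
    rw [Finset.sum_mul, ← Finset.sum_sub_distrib]
    exact Finset.sum_congr rfl fun s _ => by ring
  have hu : IsUnit G := Units.isUnit g
  have hut : IsUnit Gᵀ := (Matrix.isUnit_transpose G).2 hu
  have h0 : E = 0 := by
    have h1 : G * E = 0 := hut.mul_left_eq_zero.1 hE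
    exact hu.mul_right_eq_zero.1 h1
  have := congrFun (congrFun h0 p) q
  exact sub_eq_zero.1 this

theorem commuting_of_mem_base {d : Fin m → Derivation ℤ F F} (hd : Commuting d)
    {δ : Fin m → Derivation ℤ F F} (hδ : δ ∈ base d) : Commuting δ := by
  obtain ⟨g, hg, rfl⟩ := hδ
  exact commuting_act hd hg

theorem base_const {d δ : Fin m → Derivation ℤ F F} (hδ : δ ∈ base d) (c : constants d)
    (i : Fin m) : δ i (c : F) = 0 := by
  obtain ⟨g, -, rfl⟩ := hδ
  simp only [act, combo_apply]
  exact Finset.sum_eq_zero fun j _ => by rw [c.2 j, mul_zero]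

theorem jetOp_succ {A : Type*} [CommRing A] {D : Fin m → Derivation ℤ A A} (hD : Commuting D)
    (i : Fin m) (α : Fin m → ℕ) (a : A) :
    D i (jetOp D α a) = jetOp D (α + Pi.single i 1) a := by
  let T : Fin m → Module.End ℤ A := fun i => ((D i : A →ₗ[ℤ] A) : Module.End ℤ A)
  have hT : ∀ i j, Commute (T i) (T j) := fun i j => by
    refine LinearMap.ext fun x => ?_
    exact hD i j x
  have hnot : ∀ l : List (Fin m), i ∉ l →
      (l.map fun j => T j ^ (α + Pi.single i 1 : Fin m → ℕ) j) = l.map fun j => T j ^ α j := by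
    intro l hl
    refine List.map_congr_left fun j hj => ?_
    have : j ≠ i := fun h => hl (h ▸ hj)
    simp [this]
  have main : ∀ l : List (Fin m), l.Nodup → i ∈ l →
      T i * (l.map fun j => T j ^ α j).prod =
        (l.map fun j => T j ^ (α + Pi.single i 1 : Fin m → ℕ) j).prod := by
    intro l
    induction l with
    | nil => simp
    | cons j l ih =>
      intro hnd hi
      rw [List.nodup_cons] at hnd
      rw [List.map_cons, List.map_cons, List.prod_cons, List.prod_cons]
      by_cases hji : j = i
      · subst hji
        rw [hnot l hnd.1, ← mul_assoc, ← pow_succ']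
        simp
      · have hil : i ∈ l := by
          rcases List.mem_cons.1 hi with h | h
          · exact absurd h.symm hji
          · exact h
        rw [← ih hnd.2 hil, ← mul_assoc, ← mul_assoc, ((hT i j).pow_right (α j)).eq]
        simp [hji]
  exact LinearMap.congr_fun (main _ (List.nodup_finRange m) (List.mem_finRange i)) a

theorem evalD_formalD {R A : Type*} [CommRing R] [CommRing A] [Algebra R A] {ι : Type*}
    {D : Fin m → Derivation ℤ A A} (hD : Commuting D)
    (hc : ∀ (c : R) i, D i (algebraMap R A c) = 0) (z : ι → A) (i : Fin m)
    (p : DPoly R m ι) : evalD D z (formalD R ι i p) = D i (evalD D z p) := by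
  induction p using MvPolynomial.induction_on with
  | C c => simp [evalD, formalD, hc]
  | add p q hp hq => simp only [map_add, hp, hq]
  | mul_X p kα hp =>
    rw [Derivation.leibniz, map_mul, Derivation.leibniz, map_add, smul_eq_mul, smul_eq_mul,
      map_mul, map_mul, hp, smul_eq_mul, smul_eq_mul]
    congr 2
    simp [formalD, evalD, MvPolynomial.mkDerivation_X, jetOp_succ hD]

/-! ### Differential rational functions on a family of sets over the base -/

/-- The ideal of the differential polynomials with constant coefficients that vanish on the
family `(S δ)`, `δ ∈ 𝐁`; on `S δ` the derivations are interpreted by `δ`. -/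
def vanishingIdeal (d : Fin m → Derivation ℤ F F) {ι : Type*}
    (S : (Fin m → Derivation ℤ F F) → Set (ι → F)) : Ideal (DPoly (constants d) m ι) where
  carrier := {p | ∀ δ ∈ base d, ∀ z ∈ S δ, evalD δ z p = 0}
  add_mem' := by
    intro p q hp hq δ hδ z hz
    rw [map_add, hp δ hδ z hz, hq δ hδ z hz, add_zero]
  zero_mem' := by intro δ _ z _; exact map_zero _
  smul_mem' := by
    intro c p hp δ hδ z hz
    rw [smul_eq_mul, map_mul, hp δ hδ z hz, mul_zero]

/-- `C{S}`: the differential polynomial functions on the family `S`. -/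
def CoordRing (d : Fin m → Derivation ℤ F F) {ι : Type*}
    (S : (Fin m → Derivation ℤ F F) → Set (ι → F)) : Type _ :=
  DPoly (constants d) m ι ⧸ vanishingIdeal d S

instance (d : Fin m → Derivation ℤ F F) {ι : Type*}
    (S : (Fin m → Derivation ℤ F F) → Set (ι → F)) : CommRing (CoordRing d S) :=
  inferInstanceAs (CommRing (DPoly (constants d) m ι ⧸ vanishingIdeal d S))

instance (d : Fin m → Derivation ℤ F F) {ι : Type*}
    (S : (Fin m → Derivation ℤ F F) → Set (ι → F)) : Algebra (constants d) (CoordRing d S) :=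
  inferInstanceAs (Algebra (constants d) (DPoly (constants d) m ι ⧸ vanishingIdeal d S))

/-- The class in `C{S}` of a differential polynomial. -/
def toCoord (d : Fin m → Derivation ℤ F F) {ι : Type*}
    (S : (Fin m → Derivation ℤ F F) → Set (ι → F)) :
    DPoly (constants d) m ι →+* CoordRing d S :=
  Ideal.Quotient.mk (vanishingIdeal d S)

theorem toCoord_surjective (d : Fin m → Derivation ℤ F F) {ι : Type*}
    (S : (Fin m → Derivation ℤ F F) → Set (ι → F)) : Function.Surjective (toCoord d S) :=
  Ideal.Quotient.mk_surjective

theorem toCoord_eq_zero {d : Fin m → Derivation ℤ F F} {ι : Type*}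
    {S : (Fin m → Derivation ℤ F F) → Set (ι → F)} {p : DPoly (constants d) m ι} :
    toCoord d S p = 0 ↔ p ∈ vanishingIdeal d S :=
  Ideal.Quotient.eq_zero_iff_mem

theorem toCoord_formalD {d : Fin m → Derivation ℤ F F} (hd : Commuting d) {ι : Type*}
    (S : (Fin m → Derivation ℤ F F) → Set (ι → F)) (i : Fin m)
    (p : DPoly (constants d) m ι) (hp : toCoord d S p = 0) :
    toCoord d S (formalD (constants d) ι i p) = 0 := by
  rw [toCoord_eq_zero] at hp ⊢
  intro δ hδ z hz
  have h := evalD_formalD (commuting_of_mem_base hd hδ)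
    (fun (c : constants d) j => base_const hδ c j) z i p
  rw [hp δ hδ z hz, map_zero] at h
  exact h

/-- `C⟨S⟩`: the differential rational functions with constant coefficients on the family
`S`, that is, the total ring of fractions of `C{S}` (its field of fractions, when `C{S}` is an
integral domain). -/
def FunField (d : Fin m → Derivation ℤ F F) {ι : Type*}
    (S : (Fin m → Derivation ℤ F F) → Set (ι → F)) : Type _ :=
  FractionRing (CoordRing d S)

instance (d : Fin m → Derivation ℤ F F) {ι : Type*}
    (S : (Fin m → Derivation ℤ F F) → Set (ι → F)) : CommRing (FunField d S) :=
  inferInstanceAs (CommRing (FractionRing (CoordRing d S)))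

instance (d : Fin m → Derivation ℤ F F) {ι : Type*}
    (S : (Fin m → Derivation ℤ F F) → Set (ι → F)) : Algebra (CoordRing d S) (FunField d S) :=
  inferInstanceAs (Algebra (CoordRing d S) (FractionRing (CoordRing d S)))

instance (d : Fin m → Derivation ℤ F F) {ι : Type*}
    (S : (Fin m → Derivation ℤ F F) → Set (ι → F)) :
    IsFractionRing (CoordRing d S) (FunField d S) :=
  inferInstanceAs (IsFractionRing (CoordRing d S) (FractionRing (CoordRing d S)))

instance (d : Fin m → Derivation ℤ F F) {ι : Type*}
    (S : (Fin m → Derivation ℤ F F) → Set (ι → F)) : Algebra (constants d) (FunField d S) :=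
  inferInstanceAs (Algebra (constants d) (FractionRing (CoordRing d S)))

instance (d : Fin m → Derivation ℤ F F) {ι : Type*}
    (S : (Fin m → Derivation ℤ F F) → Set (ι → F)) :
    IsScalarTower (constants d) (CoordRing d S) (FunField d S) :=
  inferInstanceAs (IsScalarTower (constants d) (CoordRing d S) (FractionRing (CoordRing d S)))

/-- The class in `C⟨S⟩` of a differential polynomial. -/
def toFun (d : Fin m → Derivation ℤ F F) {ι : Type*}
    (S : (Fin m → Derivation ℤ F F) → Set (ι → F)) (p : DPoly (constants d) m ι) :
    FunField d S :=
  algebraMap (CoordRing d S) (FunField d S) (toCoord d S p)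

/-- `f ∈ C⟨S⟩` is defined at the point `z` and has the value `a` there. The point may have its
coordinates in any ring `A` over the constants with a system `D` of derivations. -/
def HasValue {d : Fin m → Derivation ℤ F F} {ι : Type*}
    {S : (Fin m → Derivation ℤ F F) → Set (ι → F)} {A : Type*} [CommRing A]
    [Algebra (constants d) A] (f : FunField d S) (D : Fin m → Derivation ℤ A A) (z : ι → A)
    (a : A) : Prop :=
  ∃ r s : DPoly (constants d) m ι, f * toFun d S s = toFun d S r ∧
    IsUnit (evalD D z s) ∧ a * evalD D z s = evalD D z r

/-- The extension of a derivation to the total ring of fractions (quotient rule). -/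
def fracD {A K : Type*} [CommRing A] [CommRing K] [Algebra A K] [IsFractionRing A K]
    (D : Derivation ℤ A A) : Derivation ℤ K K :=
  let φ : A →+* TrivSqZeroExt K K :=
    { toFun := fun a => TrivSqZeroExt.inl (algebraMap A K a) +
        TrivSqZeroExt.inr (algebraMap A K (D a))
      map_one' := by ext <;> simp
      map_zero' := by ext <;> simp
      map_add' := by intro a b; ext <;> simp [Algebra.smul_def]
      map_mul' := by
        intro a b
        ext
        · simp
        · simp only [TrivSqZeroExt.snd_add, TrivSqZeroExt.snd_inl, TrivSqZeroExt.snd_inr,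
            TrivSqZeroExt.snd_mul, TrivSqZeroExt.fst_add, TrivSqZeroExt.fst_inl,
            TrivSqZeroExt.fst_inr, Derivation.leibniz, smul_eq_mul, map_add, map_mul,
            op_smul_eq_smul, zero_add, add_zero] }
  have hφ : ∀ y : nonZeroDivisors A, IsUnit (φ y) := fun y => by
    rw [TrivSqZeroExt.isUnit_iff_isUnit_fst]
    simpa [φ] using IsLocalization.map_units K y
  let Φ : K →+* TrivSqZeroExt K K := IsLocalization.lift hφ
  have hfst : ∀ f, (Φ f).fst = f := by
    have h : ((TrivSqZeroExt.fstHom K K K).toRingHom.comp Φ) = RingHom.id _ := by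
      refine IsLocalization.ringHom_ext (nonZeroDivisors A) ?_
      ext a
      simp [Φ, φ]
    exact fun f => RingHom.congr_fun h f
  Derivation.mk'
    (AddMonoidHom.toIntLinearMap
      { toFun := fun f => (Φ f).snd
        map_zero' := by simp
        map_add' := fun f g => by rw [map_add]; rfl })
    (fun f g => by
      change (Φ (f * g)).snd = f • (Φ g).snd + g • (Φ f).snd
      rw [map_mul, TrivSqZeroExt.snd_mul, hfst, hfst, op_smul_eq_smul])

theorem fracD_algebraMap {A K : Type*} [CommRing A] [CommRing K] [Algebra A K]
    [IsFractionRing A K] (D : Derivation ℤ A A) (a : A) :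
    fracD (K := K) D (algebraMap A K a) = algebraMap A K (D a) := by
  change (IsLocalization.lift _ (algebraMap A K a) : TrivSqZeroExt K K).snd = _
  rw [IsLocalization.lift_eq]
  simp only [RingHom.coe_mk, MonoidHom.coe_mk, OneHom.coe_mk, TrivSqZeroExt.snd_add,
    TrivSqZeroExt.snd_inl, TrivSqZeroExt.snd_inr, zero_add]

/-- The derivation induced on the image of a surjective ring homomorphism. -/
def quotD {R A Q : Type*} [CommRing R] [CommRing A] [Algebra R A] [CommRing Q] (π : A →+* Q)
    (hπ : Function.Surjective π) (D : Derivation R A A)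
    (h : ∀ a, π a = 0 → π (D a) = 0) : Derivation ℤ Q Q :=
  Derivation.liftOfSurjective (f := π.toIntAlgHom) (d := D.restrictScalars ℤ) hπ h

theorem quotD_apply {R A Q : Type*} [CommRing R] [CommRing A] [Algebra R A] [CommRing Q]
    (π : A →+* Q) (hπ : Function.Surjective π) (D : Derivation R A A)
    (h : ∀ a, π a = 0 → π (D a) = 0) (a : A) : quotD π hπ D h (π a) = π (D a) :=
  Derivation.liftOfSurjective_apply (f := π.toIntAlgHom) (d := D.restrictScalars ℤ) hπ h a

/-- The derivation `∂ i` of the coordinate ring `C{S}`. -/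
def coordD {d : Fin m → Derivation ℤ F F} (hd : Commuting d) {ι : Type*}
    (S : (Fin m → Derivation ℤ F F) → Set (ι → F)) (i : Fin m) :
    Derivation ℤ (CoordRing d S) (CoordRing d S) :=
  quotD (toCoord d S) (toCoord_surjective d S)
    (formalD (constants d) ι i) (toCoord_formalD hd S i)

/-- The derivations `∂ i` of `C⟨S⟩`. -/
def funD {d : Fin m → Derivation ℤ F F} (hd : Commuting d) {ι : Type*}
    (S : (Fin m → Derivation ℤ F F) → Set (ι → F)) (i : Fin m) :
    Derivation ℤ (FunField d S) (FunField d S) :=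
  fracD (coordD hd S i)

theorem funD_toFun {d : Fin m → Derivation ℤ F F} (hd : Commuting d) {ι : Type*}
    (S : (Fin m → Derivation ℤ F F) → Set (ι → F)) (i : Fin m)
    (p : DPoly (constants d) m ι) :
    funD hd S i (toFun d S p) = toFun d S (formalD (constants d) ι i p) := by
  rw [funD, toFun, fracD_algebraMap, coordD, quotD_apply, toFun]

/-- The coordinate function `x k` in `C⟨S⟩`. -/
def coord (d : Fin m → Derivation ℤ F F) {ι : Type*}
    (S : (Fin m → Derivation ℤ F F) → Set (ι → F)) (k : ι) : FunField d S :=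
  toFun d S (MvPolynomial.X (k, 0))

/-! ### The groupoid action -/

/-- The indices of the components of a triple `(h, g, v)` in
`GL(n) × GL(m) × (affine l-space)`. -/
abbrev TripleIdx (n m l : ℕ) : Type := (Fin n × Fin n) ⊕ (Fin m × Fin m) ⊕ Fin l

/-- The vector of all components of `(h, g, v)`. -/
def triple {A : Type*} {n m l : ℕ} (h : Matrix (Fin n) (Fin n) A) (g : Matrix (Fin m) (Fin m) A)
    (v : Fin l → A) : TripleIdx n m l → A :=
  Sum.elim (fun ij => h ij.1 ij.2) (Sum.elim (fun ij => g ij.1 ij.2) v)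

/-- The family `G ⋄ W`, with the fibre `GL(n, F) × GL^δ(m, F) × W δ` over `δ`. -/
def diamond (n : ℕ) {l : ℕ} (W : (Fin m → Derivation ℤ F F) → Set (Fin l → F)) :
    (Fin m → Derivation ℤ F F) → Set (TripleIdx n m l → F) :=
  fun δ => {z | ∃ (h : GL (Fin n) F) (g : GL (Fin m) F) (v : Fin l → F),
    g ∈ intGL δ ∧ v ∈ W δ ∧ z = triple h.val g.val v}

/-- `C⟨W⟩^G`: the `f ∈ C⟨W⟩` with `f^(g⁻¹δ)⟨τ^δ⟨h, g; v⟩⟩ = f^δ⟨v⟩` for all `δ ∈ 𝐁`,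
`(h, g) ∈ GL(n, F) × GL^δ(m, F)`, `v ∈ W δ` for which both sides are defined. -/
def invariants {d : Fin m → Derivation ℤ F F} {n l : ℕ}
    (W : (Fin m → Derivation ℤ F F) → Set (Fin l → F))
    (τ : (Fin m → Derivation ℤ F F) → GL (Fin n) F → GL (Fin m) F → (Fin l → F) → (Fin l → F)) :
    Set (FunField d W) :=
  {f | ∀ δ ∈ base d, ∀ (h : GL (Fin n) F), ∀ g ∈ intGL δ, ∀ v ∈ W δ, ∀ a b : F,
    HasValue f δ v a → HasValue f (act g δ) (τ δ h g v) b → b = a}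

end Field

/-- The smallest subalgebra over `R` that contains `X`, is closed under the derivations `D i`,
and contains the inverse of each of its elements that is invertible in `K`. When `K` and `R` are
fields this is the `D`-differential subfield of `K` generated by `X` over `R`. -/
def diffFieldAdjoin (R : Type*) {K : Type*} [CommRing R] [CommRing K] [Algebra R K] {m : ℕ}
    (D : Fin m → Derivation ℤ K K) (X : Set K) : Subalgebra R K :=
  sInf {L | X ⊆ L ∧ (∀ i, ∀ a ∈ L, D i a ∈ L) ∧ ∀ a ∈ L, ∀ b, a * b = 1 → b ∈ L}

end DiffInv

end

noncomputable section

namespace DiffInv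

/-! ### Derivations of polynomial rings and of fields of fractions -/

/-! The proof is a moving-frame argument. For `v ∈ W₀ δ` the arrow `P⟨v⟩` carries `(δ, v)` to the
normal form `(δ', y)` with `δ' = P₁⟨v⟩⁻¹δ` and `y = τ⟨P⟨v⟩; v⟩`. Since `P⟨τ⟨h, g; v⟩⟩ = (h,
g)⁻¹P⟨v⟩`, the normal form is constant along orbits (`slice_eq`). A differential polynomial `p` in
`w = τ⟨P⟨x⟩; x⟩`, formed with `P₁⟨x⟩⁻¹∂`, has at `(δ, v)` the value of `p` at `(δ', y)`
(`hasValue_evalD_generators`). Hence quotients of such elements are invariant on `W₀`, and by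
density on `W` (`mem_invariants`).

Conversely, an invariant `f = r/s` cannot simply be evaluated at `y`, because `s` may vanish there.
But `f(v) = f(τ⟨h, g; y⟩)` for a generic arrow `(h, g)` from `y`, and the right side is a quotient
`R/S` of differential polynomials in `(h, g, y)`. Over a differentially closed field every
integrable `g` is a Jacobian matrix `δ' t` (`exists_jacobian_eq`), so `h` and `t` are free unknowns
and `r(v) S = s(v) R` is an identity of polynomials in them. Comparing one coefficient gives `f(v) =
R_μ(y)/S_μ(y)`, where `R_μ` and `S_μ` are differential polynomials over `C`
(`exists_of_mem_invariants`).

Both directions need enough points. The parametrization by `(h, t)` makes each fibre `GL(n, F) ×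
GL^δ(m, F) × W δ` irreducible (`exists_generic_arrow`). As arrows connect any two members of the
base, the vanishing ideal of the whole family `W` is prime (`isPrime_vanishingIdeal`), and an
element of `C⟨W⟩` is determined by its values on `W₀` (`eq_zero_of_values`). -/

/-- The derivations of a commutative ring. -/
abbrev Der (A : Type*) [CommRing A] : Type _ := Derivation ℤ A A

/-- The derivation of a polynomial ring that extends the derivation `δ` of the coefficients and
takes the value `u s` at the indeterminate `s`. -/
def polyD {R σ : Type*} [CommRing R] (δ : Derivation ℤ R R) (u : σ → MvPolynomial σ R) :
    Der (MvPolynomial σ R) :=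
  -- A derivation is the `ε`-part of a ring homomorphism `f ↦ f + D f ε` into the dual numbers, so
  -- the universal property of the polynomial ring yields it from the values on generators.
  let c : R →+* TrivSqZeroExt (MvPolynomial σ R) (MvPolynomial σ R) :=
    { toFun := fun a => TrivSqZeroExt.inl (MvPolynomial.C a) +
        TrivSqZeroExt.inr (MvPolynomial.C (δ a))
      map_one' := by ext <;> simp
      map_zero' := by ext <;> simp
      map_add' := by intro a b; ext <;> simp
      map_mul' := by
        intro a b
        ext1
        · simp
        · simp only [TrivSqZeroExt.snd_add, TrivSqZeroExt.snd_inl, TrivSqZeroExt.snd_inr,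
            TrivSqZeroExt.snd_mul, TrivSqZeroExt.fst_add, TrivSqZeroExt.fst_inl,
            TrivSqZeroExt.fst_inr, Derivation.leibniz, smul_eq_mul, map_add, map_mul,
            op_smul_eq_smul, zero_add, add_zero] }
  let Φ : MvPolynomial σ R →+* TrivSqZeroExt (MvPolynomial σ R) (MvPolynomial σ R) :=
    MvPolynomial.eval₂Hom c fun s => TrivSqZeroExt.inl (MvPolynomial.X s) +
      TrivSqZeroExt.inr (u s)
  have hfst : ∀ f, (Φ f).fst = f := by
    have h : ((TrivSqZeroExt.fstHom (MvPolynomial σ R) (MvPolynomial σ R)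
        (MvPolynomial σ R)).toRingHom.comp Φ) = RingHom.id _ := by
      refine MvPolynomial.ringHom_ext (fun a => ?_) fun s => ?_
      · simp [Φ, c]
      · simp [Φ]
    exact fun f => RingHom.congr_fun h f
  Derivation.mk'
    (AddMonoidHom.toIntLinearMap
      { toFun := fun f => (Φ f).snd
        map_zero' := by simp
        map_add' := fun f g => by rw [map_add]; rfl })
    (fun f g => by
      change (Φ (f * g)).snd = f • (Φ g).snd + g • (Φ f).snd
      rw [map_mul, TrivSqZeroExt.snd_mul, hfst, hfst, op_smul_eq_smul])

@[simp]
theorem polyD_C {R σ : Type*} [CommRing R] (δ : Derivation ℤ R R) (u : σ → MvPolynomial σ R)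
    (a : R) : polyD δ u (MvPolynomial.C a) = MvPolynomial.C (δ a) := by
  change (MvPolynomial.eval₂Hom _ _ (MvPolynomial.C a) : TrivSqZeroExt _ _).snd = _
  simp

@[simp]
theorem polyD_X {R σ : Type*} [CommRing R] (δ : Derivation ℤ R R) (u : σ → MvPolynomial σ R)
    (s : σ) : polyD δ u (MvPolynomial.X s) = u s := by
  change (MvPolynomial.eval₂Hom _ _ (MvPolynomial.X s) : TrivSqZeroExt _ _).snd = _
  simp

theorem derivation_eq_zero_of_generators {R σ : Type*} [CommRing R]
    (D : Der (MvPolynomial σ R))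
    (hC : ∀ a, D (MvPolynomial.C a) = 0) (hX : ∀ s, D (MvPolynomial.X s) = 0)
    (p : MvPolynomial σ R) : D p = 0 := by
  induction p using MvPolynomial.induction_on with
  | C a => exact hC a
  | add p q hp hq => rw [map_add, hp, hq, add_zero]
  | mul_X p s hp => rw [Derivation.leibniz, hp, hX, smul_zero, smul_zero, add_zero]

/-- A commutator of derivations is again a derivation, so it vanishes as soon as it kills the
coefficients and the indeterminates. -/
theorem commuting_polyD {R σ : Type*} [CommRing R] {m : ℕ} {δ : Fin m → Derivation ℤ R R}
    (hδ : Commuting δ) (u : Fin m → σ → MvPolynomial σ R)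
    (hu : ∀ i j s, polyD (δ i) (u i) (u j s) = polyD (δ j) (u j) (u i s)) :
    Commuting fun i => polyD (δ i) (u i) := by
  intro i j p
  have h := derivation_eq_zero_of_generators ⁅polyD (δ i) (u i), polyD (δ j) (u j)⁆
    (fun a => by simp [Derivation.commutator_apply, hδ i j a])
    (fun s => by simp [Derivation.commutator_apply, hu i j s]) p
  rwa [Derivation.commutator_apply, sub_eq_zero] at h

theorem commuting_fracD {A K : Type*} [CommRing A] [CommRing K] [Algebra A K]
    [IsFractionRing A K] {m : ℕ} {D : Fin m → Derivation ℤ A A} (hD : Commuting D) :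
    Commuting fun i => fracD (K := K) (D i) := by
  intro i j f
  obtain ⟨⟨r, s⟩, hrs⟩ := IsLocalization.surj (nonZeroDivisors A) f
  have hu : IsUnit (algebraMap A K s) := IsLocalization.map_units K s
  let E : Derivation ℤ K K := ⁅fracD (K := K) (D i), fracD (K := K) (D j)⁆
  have hE : ∀ a, E (algebraMap A K a) = 0 := fun a => by
    simp [E, Derivation.commutator_apply, fracD_algebraMap, hD i j a]
  have h := congrArg E hrs
  rw [Derivation.leibniz, hE, hE, smul_zero, zero_add, smul_eq_mul] at h
  have h2 := hu.mul_right_eq_zero.1 h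
  rwa [Derivation.commutator_apply, sub_eq_zero] at h2

/-! ### Jets and evaluation -/

theorem jetOp_zero {A : Type*} [CommRing A] {m : ℕ} (D : Fin m → Derivation ℤ A A) (a : A) :
    jetOp D 0 a = a := by
  have h : jetOp D 0 = 1 := by
    rw [jetOp]
    refine List.prod_eq_one fun x hx => ?_
    obtain ⟨i, -, rfl⟩ := List.mem_map.1 hx
    simp
  rw [h]
  rfl

/-- A property of families of elements that is stable under the derivations is stable under the
operators `jetOp`. -/
theorem jetOp_induction {X : Type*} {A : X → Type*} [∀ x, CommRing (A x)] {m : ℕ}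
    (D : ∀ x, Fin m → Derivation ℤ (A x) (A x)) (Q : (∀ x, A x) → Prop)
    (hQ : ∀ i a, Q a → Q fun x => D x i (a x)) (α : Fin m → ℕ) (a : ∀ x, A x) (ha : Q a) :
    Q fun x => jetOp (D x) α (a x) := by
  have hpow : ∀ (i : Fin m) (k : ℕ) (a : ∀ x, A x), Q a →
      Q fun x => (((D x i : A x →ₗ[ℤ] A x) : Module.End ℤ (A x)) ^ k) (a x) := by
    intro i k
    induction k with
    | zero => exact fun a ha => ha
    | succ k ih =>
      intro a ha
      have h := hQ i _ (ih a ha)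
      refine cast (congrArg Q ?_) h
      funext x
      rw [pow_succ']
      rfl
  have hlist : ∀ l : List (Fin m), Q fun x =>
      ((l.map fun i => ((D x i : A x →ₗ[ℤ] A x) : Module.End ℤ (A x)) ^ α i).prod) (a x) := by
    intro l
    induction l with
    | nil => exact ha
    | cons i l ih =>
      refine cast (congrArg Q ?_) (hpow i (α i) _ ih)
      funext x
      rw [List.map_cons, List.prod_cons]
      rfl
  exact hlist _

theorem jetOp_single {A : Type*} [CommRing A] {m : ℕ} {D : Fin m → Derivation ℤ A A}
    (hD : Commuting D) (i : Fin m) (a : A) : jetOp D (Pi.single i 1) a = D i a := by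
  have h := jetOp_succ hD i 0 a
  rw [jetOp_zero, zero_add] at h
  exact h.symm

/-- Induction on the order `∑ α i`, splitting off one derivation `i` with `α i ≠ 0`. It identifies
the indeterminate `(k, α)` with the derivative `∂ ^ α` of the unknown `(k, 0)`. -/
theorem jetOp_family {A : Type*} [CommRing A] {m : ℕ} {D : Fin m → Derivation ℤ A A}
    (hD : Commuting D) (a : (Fin m → ℕ) → A)
    (ha : ∀ i α, D i (a α) = a (α + Pi.single i 1)) (α : Fin m → ℕ) :
    jetOp D α (a 0) = a α := by
  obtain ⟨N, hN⟩ : ∃ N, N = ∑ i, α i := ⟨_, rfl⟩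
  induction N generalizing α with
  | zero =>
    have h : α = 0 := by
      funext i
      exact Finset.sum_eq_zero_iff.1 hN.symm i (Finset.mem_univ i)
    rw [h, jetOp_zero]
  | succ N ih =>
    obtain ⟨i, hi⟩ : ∃ i, α i ≠ 0 := by
      by_contra! hc
      simp [hc] at hN
    have hα : α - Pi.single i 1 + Pi.single i 1 = α := by
      funext j
      by_cases hj : j = i
      · subst hj
        simp
        omega
      · simp [hj]
    have hs : N = ∑ j, (α - Pi.single i 1 : Fin m → ℕ) j := by
      have h := hN
      rw [← hα] at h
      simp only [Pi.add_apply, Finset.sum_add_distrib] at h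
      rw [Finset.sum_pi_single'] at h
      simpa using h
    rw [← hα, ← jetOp_succ hD, ih _ hs, ha]

theorem jetOp_map {A B : Type*} [CommRing A] [CommRing B] {m : ℕ}
    {D : Fin m → Derivation ℤ A A} {D' : Fin m → Derivation ℤ B B} (φ : A →+* B)
    (hφ : ∀ i a, φ (D i a) = D' i (φ a)) (α : Fin m → ℕ) (a : A) :
    φ (jetOp D α a) = jetOp D' α (φ a) := by
  have hpow : ∀ (i : Fin m) (k : ℕ) (a : A),
      φ ((((D i : A →ₗ[ℤ] A) : Module.End ℤ A) ^ k) a) =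
        (((D' i : B →ₗ[ℤ] B) : Module.End ℤ B) ^ k) (φ a) := by
    intro i k
    induction k with
    | zero => exact fun a => rfl
    | succ k ih =>
      intro a
      rw [pow_succ', pow_succ', Module.End.mul_apply, Module.End.mul_apply, ← ih]
      exact hφ _ _
  have hlist : ∀ l : List (Fin m),
      φ ((l.map fun i => ((D i : A →ₗ[ℤ] A) : Module.End ℤ A) ^ α i).prod a) =
        (l.map fun i => ((D' i : B →ₗ[ℤ] B) : Module.End ℤ B) ^ α i).prod (φ a) := by
    intro l
    induction l with
    | nil => rfl
    | cons i l ih =>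
      rw [List.map_cons, List.prod_cons, List.map_cons, List.prod_cons, Module.End.mul_apply,
        Module.End.mul_apply, hpow, ih]
  exact hlist _

/-- Evaluation of differential polynomials commutes with differential homomorphisms. -/
theorem map_evalD {R A B : Type*} [CommRing R] [CommRing A] [CommRing B] [Algebra R A]
    [Algebra R B] {m : ℕ} {ι : Type*} {D : Fin m → Derivation ℤ A A}
    {D' : Fin m → Derivation ℤ B B} (φ : A →+* B)
    (hR : ∀ r : R, φ (algebraMap R A r) = algebraMap R B r)
    (hφ : ∀ i a, φ (D i a) = D' i (φ a)) (z : ι → A) (p : DPoly R m ι) :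
    φ (evalD D z p) = evalD D' (fun k => φ (z k)) p := by
  induction p using MvPolynomial.induction_on with
  | C c => simpa [evalD] using hR c
  | add p q hp hq => simp only [map_add, hp, hq]
  | mul_X p kα hp =>
    rw [map_mul, map_mul, map_mul, hp]
    congr 1
    simpa [evalD] using jetOp_map φ hφ kα.2 (z kα.1)

@[simp]
theorem evalD_X {R A : Type*} [CommRing R] [CommRing A] [Algebra R A] {m : ℕ} {ι : Type*}
    (D : Fin m → Derivation ℤ A A) (z : ι → A) (kα : ι × (Fin m → ℕ)) :
    evalD (R := R) D z (MvPolynomial.X kα) = jetOp D kα.2 (z kα.1) := by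
  simp [evalD]

@[simp]
theorem evalD_C {R A : Type*} [CommRing R] [CommRing A] [Algebra R A] {m : ℕ} {ι : Type*}
    (D : Fin m → Derivation ℤ A A) (z : ι → A) (c : R) :
    evalD D z (MvPolynomial.C c) = algebraMap R A c := by
  simp [evalD]

/-- Renaming of the unknowns of a differential polynomial. -/
def renameD {R : Type*} [CommRing R] {m : ℕ} {ι κ : Type*} (e : ι → κ) :
    DPoly R m ι →ₐ[R] DPoly R m κ :=
  MvPolynomial.rename (Prod.map e id)

theorem evalD_renameD {R A : Type*} [CommRing R] [CommRing A] [Algebra R A] {m : ℕ}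
    {ι κ : Type*} (D : Fin m → Derivation ℤ A A) (e : ι → κ) (z : κ → A) (p : DPoly R m ι) :
    evalD D z (renameD e p) = evalD D (z ∘ e) p := by
  rw [evalD, renameD, MvPolynomial.aeval_rename]
  rfl

/-! ### Differential polynomials over a differential ring -/

/-- The `i`-th derivation of the ring of differential polynomials over a ring with the system
`δ` of derivations. -/
def extD {R : Type*} [CommRing R] {m : ℕ} (δ : Fin m → Derivation ℤ R R) (ι : Type*)
    (i : Fin m) : Der (DPoly R m ι) :=
  polyD (δ i) fun kα => MvPolynomial.X (kα.1, kα.2 + Pi.single i 1)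

theorem extD_C {R : Type*} [CommRing R] {m : ℕ} (δ : Fin m → Derivation ℤ R R) (ι : Type*)
    (i : Fin m) (a : R) : extD δ ι i (MvPolynomial.C a) = MvPolynomial.C (δ i a) :=
  polyD_C _ _ _

theorem extD_X {R : Type*} [CommRing R] {m : ℕ} (δ : Fin m → Derivation ℤ R R) (ι : Type*)
    (i : Fin m) (kα : ι × (Fin m → ℕ)) : extD δ ι i (MvPolynomial.X kα) =
      MvPolynomial.X (kα.1, kα.2 + Pi.single i 1) :=
  polyD_X _ _ _

theorem commuting_extD {R : Type*} [CommRing R] {m : ℕ} {δ : Fin m → Derivation ℤ R R}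
    (hδ : Commuting δ) (ι : Type*) : Commuting (extD δ ι) :=
  commuting_polyD hδ _ fun i j s => by
    simp only [polyD_X]
    rw [add_right_comm]

theorem jetOp_extD_X {R : Type*} [CommRing R] {m : ℕ} {δ : Fin m → Derivation ℤ R R}
    (hδ : Commuting δ) {ι : Type*} (k : ι) (α : Fin m → ℕ) :
    jetOp (extD δ ι) α (MvPolynomial.X (k, 0)) = MvPolynomial.X (k, α) :=
  jetOp_family (commuting_extD hδ ι) (fun α => MvPolynomial.X (k, α))
    (fun i α => extD_X δ ι i (k, α)) α

/-- The unknowns form a generic point: no nonzero differential polynomial vanishes there. -/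
theorem evalD_generic {R : Type*} [CommRing R] {m : ℕ} {δ : Fin m → Derivation ℤ R R}
    (hδ : Commuting δ) {ι : Type*} (p : DPoly R m ι) :
    evalD (extD δ ι) (fun k => MvPolynomial.X (k, 0)) p = p := by
  induction p using MvPolynomial.induction_on with
  | C c => simp [MvPolynomial.algebraMap_eq]
  | add p q hp hq => rw [map_add, hp, hq]
  | mul_X p kα hp => rw [map_mul, hp, evalD_X, jetOp_extD_X hδ]

theorem evalD_extD {R A : Type*} [CommRing R] [CommRing A] [Algebra R A] {m : ℕ} {ι : Type*}
    {δ : Fin m → Derivation ℤ R R} {D : Fin m → Derivation ℤ A A} (hD : Commuting D)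
    (hc : ∀ i r, D i (algebraMap R A r) = algebraMap R A (δ i r)) (z : ι → A) (i : Fin m)
    (p : DPoly R m ι) : evalD D z (extD δ ι i p) = D i (evalD D z p) := by
  induction p using MvPolynomial.induction_on with
  | C c => rw [extD_C, evalD_C, evalD_C, hc]
  | add p q hp hq => simp only [map_add, hp, hq]
  | mul_X p kα hp =>
    rw [Derivation.leibniz, map_mul, Derivation.leibniz, map_add, smul_eq_mul, smul_eq_mul,
      map_mul, map_mul, hp, smul_eq_mul, smul_eq_mul, extD_X, evalD_X, evalD_X, jetOp_succ hD]

theorem map_extD {R S : Type*} [CommRing R] [CommRing S] {m : ℕ} {ι : Type*}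
    {δ : Fin m → Derivation ℤ R R} {δ' : Fin m → Derivation ℤ S S} (φ : R →+* S)
    (hφ : ∀ i a, φ (δ i a) = δ' i (φ a)) (i : Fin m) (p : DPoly R m ι) :
    MvPolynomial.map φ (extD δ ι i p) = extD δ' ι i (MvPolynomial.map φ p) := by
  induction p using MvPolynomial.induction_on with
  | C c => rw [extD_C, MvPolynomial.map_C, MvPolynomial.map_C, extD_C, hφ]
  | add p q hp hq => simp only [map_add, hp, hq]
  | mul_X p kα hp =>
    rw [Derivation.leibniz, map_mul, Derivation.leibniz, map_add, smul_eq_mul, smul_eq_mul,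
      map_mul, map_mul, hp, smul_eq_mul, smul_eq_mul, extD_X, MvPolynomial.map_X,
      MvPolynomial.map_X, extD_X]

/-! ### Differentially closed fields -/

section Field

variable {F : Type u} [Field F] {m : ℕ}

/-- A nonzero differential polynomial over a differentially closed field does not vanish
identically. -/
theorem IsDiffClosed.exists_evalD_ne_zero {d : Fin m → Derivation ℤ F F} (hd : Commuting d)
    (hF : IsDiffClosed d) {ι : Type*} [Finite ι] {q : DPoly F m ι} (hq : q ≠ 0) :
    ∃ z : ι → F, evalD d z q ≠ 0 := by
  obtain ⟨k, ⟨e⟩⟩ := Finite.exists_equiv_fin ι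
  have hq2 : renameD (R := F) (m := m) e q ≠ 0 := by
    refine fun h => hq (MvPolynomial.rename_injective (Prod.map e id)
      (e.injective.prodMap Function.injective_id) ?_)
    rw [map_zero]
    exact h
  -- The generic point, over the field of fractions of the differential polynomials, solves the
  -- inequation; there are no equations.
  obtain ⟨z, -, hz⟩ := hF k ∅ (renameD e q) ⟨FractionRing (DPoly F m (Fin k)),
    inferInstance, inferInstance, fun i => fracD (extD d (Fin k) i),
    commuting_fracD (commuting_extD hd _), fun i a => by
      rw [IsScalarTower.algebraMap_apply F (DPoly F m (Fin k)), fracD_algebraMap,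
        MvPolynomial.algebraMap_eq, extD_C,
        IsScalarTower.algebraMap_apply F (DPoly F m (Fin k)), MvPolynomial.algebraMap_eq],
    fun j => algebraMap (DPoly F m (Fin k)) _ (MvPolynomial.X (j, 0)), by simp, by
      rw [← map_evalD (D := extD d (Fin k)) (algebraMap (DPoly F m (Fin k)) _)
        (fun r => (IsScalarTower.algebraMap_apply _ _ _ r).symm)
        (fun i a => (fracD_algebraMap _ _).symm), evalD_generic hd]
      simpa using hq2⟩
  exact ⟨z ∘ e, by rwa [evalD_renameD] at hz⟩

/-- A closed covector over a differentially closed field is a gradient. -/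
theorem IsDiffClosed.exists_potential {d : Fin m → Derivation ℤ F F} (hd : Commuting d)
    (hF : IsDiffClosed d) {c : Fin m → F} (hc : ∀ i j, d i (c j) = d j (c i)) :
    ∃ y, ∀ i, d i y = c i := by
  classical
  -- Adjoin an indeterminate `y` with `∂ i y = c i`. The closedness of `c` is exactly the condition
  -- that the extended derivations commute.
  let D : Fin m → Der (MvPolynomial Unit F) :=
    fun i => polyD (d i) fun _ => MvPolynomial.C (c i)
  have hD : Commuting D := commuting_polyD hd _ fun i j s => by simp [hc i j]
  have hD2 : Commuting fun i => fracD (K := FractionRing (MvPolynomial Unit F)) (D i) :=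
    commuting_fracD hD
  obtain ⟨z, hz, -⟩ := hF 1
    (Finset.univ.image fun i => MvPolynomial.X (0, Pi.single i 1) - MvPolynomial.C (c i)) 1
    ⟨FractionRing (MvPolynomial Unit F), inferInstance, inferInstance, fun i => fracD (D i),
    hD2, fun i a => by
      rw [IsScalarTower.algebraMap_apply F (MvPolynomial Unit F), fracD_algebraMap,
        MvPolynomial.algebraMap_eq, polyD_C,
        IsScalarTower.algebraMap_apply F (MvPolynomial Unit F), MvPolynomial.algebraMap_eq],
    fun _ => algebraMap (MvPolynomial Unit F) _ (MvPolynomial.X ()), by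
      intro p hp
      obtain ⟨i, -, rfl⟩ := Finset.mem_image.1 hp
      rw [map_sub, evalD_X, evalD_C, jetOp_single hD2, fracD_algebraMap, polyD_X,
        IsScalarTower.algebraMap_apply F (MvPolynomial Unit F), MvPolynomial.algebraMap_eq,
        sub_self], by simp⟩
  refine ⟨z 0, fun i => ?_⟩
  have h := hz _ (Finset.mem_image_of_mem _ (Finset.mem_univ i))
  rwa [map_sub, evalD_X, evalD_C, jetOp_single hd, sub_eq_zero] at h

/-! ### The groupoid of changes of derivations -/

theorem act_one (d : Fin m → Derivation ℤ F F) : act 1 d = d := by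
  funext i
  ext x
  simp [act, combo_apply, Matrix.one_apply]

theorem act_act (g g₁ : GL (Fin m) F) (d : Fin m → Derivation ℤ F F) :
    act g₁ (act g d) = act (g * g₁) d := by
  funext i
  ext x
  simp only [act, combo_apply, mul_inv_rev, Units.val_mul, Matrix.mul_apply, Finset.sum_mul,
    Finset.mul_sum]
  rw [Finset.sum_comm]
  exact Finset.sum_congr rfl fun j _ => Finset.sum_congr rfl fun k _ => by ring

theorem one_mem_intGL (d : Fin m → Derivation ℤ F F) : (1 : GL (Fin m) F) ∈ intGL d := by
  intro i j k
  simp only [Units.val_one, Matrix.one_apply]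
  split_ifs <;> simp

/-- Expand by the Leibniz rule and write `∂ = g (g⁻¹∂)` where `∂` hits `g₁`. One sum is symmetric in
`i, j` by integrability of `g`, the other by that of `g₁` for `g⁻¹∂`. -/
theorem mul_mem_intGL {d : Fin m → Derivation ℤ F F} {g g₁ : GL (Fin m) F} (hg : g ∈ intGL d)
    (hg₁ : g₁ ∈ intGL (act g d)) : g * g₁ ∈ intGL d := by
  have key : ∀ i j k, d i ((g * g₁ : GL (Fin m) F) j k) =
      ∑ a, g₁ a k * d i (g j a) + ∑ a, ∑ b, g j a * g i b * act g d b (g₁ a k) := by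
    intro i j k
    rw [Units.val_mul, Matrix.mul_apply, map_sum, ← Finset.sum_add_distrib]
    refine Finset.sum_congr rfl fun a _ => ?_
    rw [Derivation.leibniz, smul_eq_mul, smul_eq_mul, sum_act g d i (g₁ a k), Finset.mul_sum,
      add_comm]
    congr 1
    exact Finset.sum_congr rfl fun b _ => by ring
  intro i j k
  rw [key, key]
  congr 1
  · exact Finset.sum_congr rfl fun a _ => by rw [hg i j a]
  · rw [Finset.sum_comm]
    refine Finset.sum_congr rfl fun a _ => Finset.sum_congr rfl fun b _ => ?_
    rw [hg₁ a b k]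
    ring

/-- Differentiating `g H = 1` gives `∂H = -H (∂g) H`. After contraction with `H` the derivative
`(g⁻¹∂) i (H j k)` is a sum of terms `H i c * H j a * H b k * ∂ c (g a b)`, and integrability of `g`
allows `a` and `c` to be exchanged. -/
theorem inv_mem_intGL {d : Fin m → Derivation ℤ F F} {g : GL (Fin m) F} (hg : g ∈ intGL d) :
    g⁻¹ ∈ intGL (act g d) := by
  let H : Matrix (Fin m) (Fin m) F := (g⁻¹ : GL (Fin m) F).val
  have hGH : ∀ a b, ∑ c, g a c * H c b = (1 : Matrix (Fin m) (Fin m) F) a b := fun a b => by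
    rw [← Matrix.mul_apply, ← Units.val_mul, mul_inv_cancel, Units.val_one]
  have hHG : ∀ a b, ∑ c, H a c * g c b = (1 : Matrix (Fin m) (Fin m) F) a b := fun a b => by
    rw [← Matrix.mul_apply, ← Units.val_mul, inv_mul_cancel, Units.val_one]
  have h1 : ∀ c a k, ∑ b, g a b * d c (H b k) = - ∑ b, H b k * d c (g a b) := by
    intro c a k
    have h := congrArg (d c) (hGH a k)
    have h0 : d c ((1 : Matrix (Fin m) (Fin m) F) a k) = 0 := by
      rw [Matrix.one_apply]
      split_ifs <;> simp
    rw [h0, map_sum] at h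
    simp only [Derivation.leibniz, smul_eq_mul, Finset.sum_add_distrib] at h
    exact eq_neg_of_add_eq_zero_left h
  have h2 : ∀ c j k, d c (H j k) = - ∑ a, ∑ b, H j a * H b k * d c (g a b) := by
    intro c j k
    have h3 : ∑ a, H j a * ∑ b, g a b * d c (H b k) = d c (H j k) := by
      simp only [Finset.mul_sum, ← mul_assoc]
      rw [Finset.sum_comm]
      simp only [← Finset.sum_mul, hHG, Matrix.one_apply, ite_mul, one_mul, zero_mul,
        Finset.sum_ite_eq, Finset.mem_univ, if_true]
    rw [← h3, ← Finset.sum_neg_distrib]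
    refine Finset.sum_congr rfl fun a _ => ?_
    rw [h1, mul_neg, Finset.mul_sum]
    congr 1
    exact Finset.sum_congr rfl fun b _ => by ring
  have h4 : ∀ i j k, act g d i (H j k) =
      - ∑ c, ∑ a, ∑ b, H i c * H j a * H b k * d c (g a b) := by
    intro i j k
    rw [act, combo_apply, ← Finset.sum_neg_distrib]
    refine Finset.sum_congr rfl fun c _ => ?_
    rw [h2, mul_neg, Finset.mul_sum]
    congr 1
    refine Finset.sum_congr rfl fun a _ => ?_
    rw [Finset.mul_sum]
    exact Finset.sum_congr rfl fun b _ => by ring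
  intro i j k
  change act g d i (H j k) = act g d j (H i k)
  rw [h4, h4, Finset.sum_comm]
  refine congrArg _ (Finset.sum_congr rfl fun a _ => Finset.sum_congr rfl fun c _ =>
    Finset.sum_congr rfl fun b _ => ?_)
  rw [hg c a b]
  ring

theorem self_mem_base (d : Fin m → Derivation ℤ F F) : d ∈ base d :=
  ⟨1, one_mem_intGL d, (act_one d).symm⟩

theorem act_mem_base {d δ : Fin m → Derivation ℤ F F} (hδ : δ ∈ base d) {g : GL (Fin m) F}
    (hg : g ∈ intGL δ) : act g δ ∈ base d := by
  obtain ⟨g₀, hg₀, rfl⟩ := hδ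
  exact ⟨g₀ * g, mul_mem_intGL hg₀ hg, act_act _ _ _⟩

/-- Any two members of the base are connected by an arrow. -/
theorem exists_act_eq {d δ δ₁ : Fin m → Derivation ℤ F F} (hδ : δ ∈ base d)
    (hδ₁ : δ₁ ∈ base d) : ∃ g ∈ intGL δ, act g δ = δ₁ := by
  obtain ⟨g₀, hg₀, rfl⟩ := hδ
  obtain ⟨g₁, hg₁, rfl⟩ := hδ₁
  have h0 : act g₀⁻¹ (act g₀ d) = d := by rw [act_act, mul_inv_cancel, act_one]
  refine ⟨g₀⁻¹ * g₁, mul_mem_intGL (inv_mem_intGL hg₀) (by rwa [h0]), ?_⟩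
  rw [← act_act, h0]

/-- The members of the base of a differentially closed field are differentially closed. -/
theorem IsDiffClosed.transport {d : Fin m → Derivation ℤ F F} (hd : Commuting d)
    (hF : IsDiffClosed d) {g : GL (Fin m) F} (hg : g ∈ intGL d) :
    IsDiffClosed (act g d) := by
  classical
  intro k E q
  rintro ⟨L, _, _, D, hD, hDF, z, hz, hq⟩
  let H : Matrix (Fin m) (Fin m) F := (g⁻¹ : GL (Fin m) F).val
  -- `tr p` rewrites a differential polynomial in `g⁻¹∂` as one in `∂`: it is the value of `p` at
  -- the unknowns under the system `g⁻¹∂`.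
  let δ : Fin m → Der (DPoly F m (Fin k)) :=
    combo (H.map MvPolynomial.C) (extD d (Fin k))
  let tr : DPoly F m (Fin k) → DPoly F m (Fin k) :=
    fun p => evalD δ (fun j => MvPolynomial.X (j, 0)) p
  have htr : ∀ (M : Type u) (_ : Field M) (_ : Algebra F M) (D' D₀ : Fin m → Derivation ℤ M M)
      (_ : Commuting D₀) (_ : ∀ i a, D₀ i (algebraMap F M a) = algebraMap F M (d i a))
      (_ : ∀ i x, D' i x = ∑ j, algebraMap F M (H i j) * D₀ j x) (z : Fin k → M)
      (p : DPoly F m (Fin k)), evalD D₀ z (tr p) = evalD D' z p := by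
    intro M _ _ D' D₀ hD₀ hc hD' z p
    have h := map_evalD (D := δ) (D' := D') ((evalD (R := F) D₀ z : DPoly F m (Fin k) →ₐ[F] M) :
        DPoly F m (Fin k) →+* M) (fun r => AlgHom.commutes (evalD (R := F) D₀ z) r)
      (fun i a => by
        simp only [δ, combo_apply, hD']
        rw [map_sum]
        refine Finset.sum_congr rfl fun j _ => ?_
        rw [map_mul]
        congr 1
        · simp
        · exact evalD_extD hD₀ hc z j a) (fun j => MvPolynomial.X (j, 0)) p
    simp only [RingHom.coe_coe, evalD_X, jetOp_zero] at h
    exact h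
  let gL : GL (Fin m) L := Matrix.GeneralLinearGroup.map (algebraMap F L) g
  have hgL : ∀ i j, gL i j = algebraMap F L (g i j) := fun i j => rfl
  have hgLi : ∀ i j, (gL⁻¹ : GL (Fin m) L) i j = algebraMap F L (H i j) := fun i j => by
    rw [← map_inv]
    rfl
  -- The extension `D` of `g⁻¹∂` is turned back into the extension `g D` of `∂`. Its members commute
  -- because `g⁻¹` is integrable for `g⁻¹∂`.
  have hg' : gL⁻¹ ∈ intGL D := fun i j k => by
    rw [hgLi, hgLi, hDF, hDF]
    exact congrArg _ (inv_mem_intGL hg i j k)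
  have hback : act gL (act gL⁻¹ D) = D := by
    rw [act_act, inv_mul_cancel, act_one]
  have hD₀ : ∀ i a, act gL⁻¹ D i (algebraMap F L a) = algebraMap F L (d i a) := fun i a => by
    rw [sum_act g d i a, map_sum, act, combo_apply, inv_inv]
    refine Finset.sum_congr rfl fun j _ => ?_
    rw [hDF, map_mul, hgL]
  have htrL : ∀ p, evalD (act gL⁻¹ D) z (tr p) = evalD D z p :=
    htr L _ _ D (act gL⁻¹ D) (commuting_act hD hg') hD₀ (fun i x => by
      conv_lhs => rw [← hback]
      rw [act, combo_apply]
      exact Finset.sum_congr rfl fun j _ => by rw [hgLi]) z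
  obtain ⟨x, hx, hxq⟩ := hF k (E.image tr) (tr q) ⟨L, inferInstance, inferInstance,
    act gL⁻¹ D, commuting_act hD hg', hD₀, z, by
      intro _ hp
      obtain ⟨p, hpE, rfl⟩ := Finset.mem_image.1 hp
      rw [htrL]
      exact hz p hpE, by rwa [htrL]⟩
  refine ⟨x, fun p hp => ?_, ?_⟩
  · rw [← htr F _ _ (act g d) d hd (fun _ _ => rfl) (fun i y => combo_apply _ _ _ _)]
    exact hx _ (Finset.mem_image_of_mem _ hp)
  · rwa [← htr F _ _ (act g d) d hd (fun _ _ => rfl) (fun i y => combo_apply _ _ _ _)]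

theorem isDiffClosed_of_mem_base {d δ : Fin m → Derivation ℤ F F} (hd : Commuting d)
    (hF : IsDiffClosed d) (hδ : δ ∈ base d) : IsDiffClosed δ := by
  obtain ⟨g, hg, rfl⟩ := hδ
  exact hF.transport hd hg

end Field

end DiffInv

namespace DiffInv

/-! ### Matrices with entries in a subring -/

/-- Intended for the subrings `valueGraph` and `regularAt`: statements about values and regularity
of determinants, adjugates and differential polynomials become closure properties of a subring. -/
theorem det_mem_subring {A : Type*} [CommRing A] {ι : Type*} [Fintype ι] [DecidableEq ι]
    {Γ : Subring A} {M : Matrix ι ι A} (hM : ∀ i j, M i j ∈ Γ) : M.det ∈ Γ := by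
  let N : Matrix ι ι Γ := Matrix.of fun i j => ⟨M i j, hM i j⟩
  have h : M = Γ.subtype.mapMatrix N := rfl
  rw [h, ← RingHom.map_det]
  exact N.det.2

theorem adjugate_mem_subring {A : Type*} [CommRing A] {ι : Type*} [Fintype ι] [DecidableEq ι]
    {Γ : Subring A} {M : Matrix ι ι A} (hM : ∀ i j, M i j ∈ Γ) (i j : ι) :
    M.adjugate i j ∈ Γ := by
  let N : Matrix ι ι Γ := Matrix.of fun i j => ⟨M i j, hM i j⟩
  have h : M = Γ.subtype.mapMatrix N := rfl
  rw [h, ← RingHom.map_adjugate]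
  exact (N.adjugate i j).2

theorem evalD_mem_subring {R A : Type*} [CommRing R] [CommRing A] [Algebra R A] {m : ℕ}
    {ι : Type*} {Γ : Subring A} {D : Fin m → Derivation ℤ A A}
    (hR : ∀ r : R, algebraMap R A r ∈ Γ) (hD : ∀ i, ∀ a ∈ Γ, D i a ∈ Γ) {z : ι → A}
    (hz : ∀ k, z k ∈ Γ) (p : DPoly R m ι) : evalD D z p ∈ Γ := by
  induction p using MvPolynomial.induction_on with
  | C c => rw [evalD_C]; exact hR c
  | add p q hp hq => rw [map_add]; exact Γ.add_mem hp hq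
  | mul_X p kα hp =>
    rw [map_mul, evalD_X]
    exact Γ.mul_mem hp (jetOp_induction (X := Unit) (fun _ => D) (fun a => a () ∈ Γ)
      (fun i a ha => hD i _ ha) kα.2 (fun _ => z kα.1) (hz _))

/-- The derivation of a product that acts componentwise. -/
def prodD {A B : Type*} [CommRing A] [CommRing B] (D : Derivation ℤ A A)
    (E : Derivation ℤ B B) : Der (A × B) :=
  Derivation.mk'
    (AddMonoidHom.toIntLinearMap
      { toFun := fun x => (D x.1, E x.2)
        map_zero' := by simp
        map_add' := fun x y => by simp })
    (fun x y => by ext <;> simp)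

section Field

variable {F : Type u} [Field F] {m : ℕ} {d : Fin m → Derivation ℤ F F} {ι : Type*}

/-! ### Values of differential rational functions -/

section Values

variable {S : (Fin m → Derivation ℤ F F) → Set (ι → F)}

theorem toFun_add (p q : DPoly (constants d) m ι) :
    toFun d S (p + q) = toFun d S p + toFun d S q := by simp [toFun]

theorem toFun_mul (p q : DPoly (constants d) m ι) :
    toFun d S (p * q) = toFun d S p * toFun d S q := by simp [toFun]

theorem toFun_one : toFun d S 1 = 1 := by simp [toFun]

theorem toFun_eq_zero {p : DPoly (constants d) m ι} :
    toFun d S p = 0 ↔ p ∈ vanishingIdeal d S := by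
  rw [toFun, IsFractionRing.to_map_eq_zero_iff, toCoord_eq_zero]

theorem evalD_eq_of_toFun_eq {p q : DPoly (constants d) m ι} (h : toFun d S p = toFun d S q)
    {δ : Fin m → Derivation ℤ F F} (hδ : δ ∈ base d) {z : ι → F} (hz : z ∈ S δ) :
    evalD δ z p = evalD δ z q := by
  have h2 : toFun d S (p - q) = 0 := by
    have h3 := toFun_add (d := d) (S := S) (p - q) q
    rw [sub_add_cancel, h] at h3
    simpa using h3
  have h3 := toFun_eq_zero.1 h2 δ hδ z hz
  rwa [map_sub, sub_eq_zero] at h3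

/-- Two representations satisfy `r s' = r' s` in `C⟨S⟩`. This identity may be evaluated at `z` only
because `z` lies in the family `S`. -/
theorem HasValue.unique {δ : Fin m → Derivation ℤ F F} (hδ : δ ∈ base d) {z : ι → F}
    (hz : z ∈ S δ) {f : FunField d S} {a b : F} (ha : HasValue f δ z a)
    (hb : HasValue f δ z b) : a = b := by
  obtain ⟨r, s, h, hs, ha⟩ := ha
  obtain ⟨r', s', h', hs', hb⟩ := hb
  have h1 : toFun d S (r * s') = toFun d S (r' * s) := by
    rw [toFun_mul, toFun_mul, ← h, ← h']
    ring
  have h2 := evalD_eq_of_toFun_eq h1 hδ hz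
  rw [map_mul, map_mul, ← ha, ← hb] at h2
  refine mul_right_cancel₀ (mul_ne_zero hs.ne_zero hs'.ne_zero) ?_
  linear_combination h2

theorem hasValue_toFun (δ : Fin m → Derivation ℤ F F) (z : ι → F)
    (p : DPoly (constants d) m ι) : HasValue (toFun d S p) δ z (evalD δ z p) :=
  ⟨p, 1, by rw [toFun_one, mul_one], by simp, by simp⟩

variable (d S) in
/-- The pairs of a differential rational function defined at a point and of its value. -/
def valueGraph (δ : Fin m → Derivation ℤ F F) (z : ι → F) : Subring (FunField d S × F) where
  carrier := {x | HasValue x.1 δ z x.2}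
  one_mem' := ⟨1, 1, by simp, by simp, by simp⟩
  zero_mem' := ⟨0, 1, by simp [toFun], by simp, by simp⟩
  mul_mem' := by
    rintro x y ⟨r, s, h, hs, ha⟩ ⟨r', s', h', hs', ha'⟩
    refine ⟨r * r', s * s', ?_, ?_, ?_⟩
    · rw [toFun_mul, toFun_mul, ← h, ← h', Prod.fst_mul]
      ring
    · rw [map_mul]
      exact hs.mul hs'
    · rw [map_mul, map_mul, ← ha, ← ha', Prod.snd_mul]
      ring
  add_mem' := by
    rintro x y ⟨r, s, h, hs, ha⟩ ⟨r', s', h', hs', ha'⟩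
    refine ⟨r * s' + r' * s, s * s', ?_, ?_, ?_⟩
    · rw [toFun_add, toFun_mul, toFun_mul, toFun_mul, ← h, ← h', Prod.fst_add]
      ring
    · rw [map_mul]
      exact hs.mul hs'
    · rw [map_mul, map_add, map_mul, map_mul, ← ha, ← ha', Prod.snd_add]
      ring
  neg_mem' := by
    rintro x ⟨r, s, h, hs, ha⟩
    refine ⟨-r, s, ?_, hs, ?_⟩
    · have h2 : toFun d S (-r) = -toFun d S r := by simp [toFun]
      rw [h2, ← h, Prod.fst_neg, neg_mul]
    · rw [map_neg, ← ha, Prod.snd_neg, neg_mul]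

theorem hasValue_constant (δ : Fin m → Derivation ℤ F F) (z : ι → F) (c : constants d) :
    HasValue (algebraMap (constants d) (FunField d S) c) δ z (algebraMap (constants d) F c) := by
  have h := hasValue_toFun (d := d) (S := S) δ z (MvPolynomial.C c)
  rw [evalD_C] at h
  exact h

theorem HasValue.mul {δ : Fin m → Derivation ℤ F F} {z : ι → F} {f g : FunField d S} {a b : F}
    (ha : HasValue f δ z a) (hb : HasValue g δ z b) : HasValue (f * g) δ z (a * b) :=
  (valueGraph d S δ z).mul_mem (x := (f, a)) (y := (g, b)) ha hb

theorem HasValue.sub {δ : Fin m → Derivation ℤ F F} {z : ι → F} {f g : FunField d S} {a b : F}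
    (ha : HasValue f δ z a) (hb : HasValue g δ z b) : HasValue (f - g) δ z (a - b) :=
  (valueGraph d S δ z).sub_mem (x := (f, a)) (y := (g, b)) ha hb

theorem HasValue.sum {δ : Fin m → Derivation ℤ F F} {z : ι → F} {κ : Type*} (t : Finset κ)
    {f : κ → FunField d S} {a : κ → F} (h : ∀ k, HasValue (f k) δ z (a k)) :
    HasValue (∑ k ∈ t, f k) δ z (∑ k ∈ t, a k) := by
  have h2 := (valueGraph d S δ z).sum_mem (t := t) (f := fun k => (f k, a k)) fun k _ => h k
  have h3 : (∑ k ∈ t, (f k, a k)) = (∑ k ∈ t, f k, ∑ k ∈ t, a k) :=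
    Prod.ext (by simp [Prod.fst_sum]) (by simp [Prod.snd_sum])
  rwa [h3] at h2

theorem HasValue.inv {δ : Fin m → Derivation ℤ F F} {z : ι → F} {f g : FunField d S} {a : F}
    (ha : HasValue f δ z a) (hfg : f * g = 1) (h0 : a ≠ 0) : HasValue g δ z a⁻¹ := by
  obtain ⟨r, s, h, hs, ha⟩ := ha
  refine ⟨s, r, ?_, ?_, ?_⟩
  · rw [← h, ← mul_assoc, mul_comm g, hfg, one_mul]
  · rw [← ha]
    exact (isUnit_iff_ne_zero.2 h0).mul hs
  · rw [← ha, inv_mul_cancel_left₀ h0]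

/-- Over the fibre at `δ` the formal derivation acts as `δ i`. Differentiating both `f s = r` and
its evaluation at `z` leads to the same quotient rule, with denominator `s²`. -/
theorem HasValue.derivation (hd : Commuting d) {δ : Fin m → Derivation ℤ F F}
    (hδ : δ ∈ base d) {z : ι → F} {f : FunField d S} {a : F} (ha : HasValue f δ z a)
    (i : Fin m) : HasValue (funD hd S i f) δ z (δ i a) := by
  obtain ⟨r, s, h, hs, ha⟩ := ha
  have hδc := commuting_of_mem_base hd hδ
  have hcc := fun (c : constants d) j => base_const hδ c j
  have h1 := congrArg (funD hd S i) h
  have h2 := congrArg (δ i) ha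
  rw [Derivation.leibniz, smul_eq_mul, smul_eq_mul, funD_toFun, funD_toFun] at h1
  rw [Derivation.leibniz, smul_eq_mul, smul_eq_mul, ← evalD_formalD hδc hcc,
    ← evalD_formalD hδc hcc] at h2
  refine ⟨formalD _ ι i r * s - r * formalD _ ι i s, s * s, ?_, ?_, ?_⟩
  · have h3 : ∀ p q : DPoly (constants d) m ι,
        toFun d S (p - q) = toFun d S p - toFun d S q := fun p q => by simp [toFun]
    rw [h3, toFun_mul, toFun_mul, toFun_mul, ← h1, ← h]
    ring
  · rw [map_mul]
    exact hs.mul hs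
  · rw [map_sub, map_mul, map_mul, map_mul, ← h2, ← ha]
    ring

/-- The value of a quotient. -/
theorem HasValue.of_mul {δ : Fin m → Derivation ℤ F F} {z : ι → F} {f e r : FunField d S}
    {a b : F} (h : f * e = r) (he : HasValue e δ z a) (h0 : a ≠ 0) (hr : HasValue r δ z b) :
    HasValue f δ z (b / a) := by
  obtain ⟨r₁, s₁, h₁, hs₁, h₁a⟩ := he
  obtain ⟨r₂, s₂, h₂, hs₂, h₂b⟩ := hr
  refine ⟨r₂ * s₁, r₁ * s₂, ?_, ?_, ?_⟩
  · rw [toFun_mul, toFun_mul, ← h₁, ← h₂, ← h]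
    ring
  · rw [map_mul, ← h₁a]
    exact ((isUnit_iff_ne_zero.2 h0).mul hs₁).mul hs₂
  · rw [map_mul, map_mul, ← h₁a, ← h₂b]
    field_simp

theorem HasValue.det {δ : Fin m → Derivation ℤ F F} {z : ι → F} {κ : Type*} [Fintype κ]
    [DecidableEq κ] {p : Matrix κ κ (FunField d S)} {P : Matrix κ κ F}
    (h : ∀ i j, HasValue (p i j) δ z (P i j)) : HasValue p.det δ z P.det := by
  let N : Matrix κ κ (FunField d S × F) := Matrix.of fun i j => (p i j, P i j)
  have h1 : (RingHom.fst (FunField d S) F).mapMatrix N = p := rfl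
  have h2 : (RingHom.snd (FunField d S) F).mapMatrix N = P := rfl
  have h3 := det_mem_subring (Γ := valueGraph d S δ z) (M := N) h
  rw [← h1, ← h2, ← RingHom.map_det, ← RingHom.map_det]
  exact h3

theorem HasValue.matrix_inv {δ : Fin m → Derivation ℤ F F} {z : ι → F} {κ : Type*} [Fintype κ]
    [DecidableEq κ] {p : Matrix κ κ (FunField d S)} {P : GL κ F} (hp : IsUnit p)
    (h : ∀ i j, HasValue (p i j) δ z (P i j)) (i j : κ) :
    HasValue (p⁻¹ i j) δ z ((P⁻¹ : GL κ F) i j) := by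
  let N : Matrix κ κ (FunField d S × F) := Matrix.of fun i j => (p i j, P i j)
  have hN : ∀ i j, N i j ∈ valueGraph d S δ z := h
  have h1 : (RingHom.fst (FunField d S) F).mapMatrix N = p := rfl
  have h2 : (RingHom.snd (FunField d S) F).mapMatrix N = P.val := rfl
  have hdet : HasValue p.det δ z P.val.det := HasValue.det h
  have hadj : HasValue (p.adjugate i j) δ z (P.val.adjugate i j) := by
    have h3 := adjugate_mem_subring hN i j
    rw [← h1, ← h2, ← RingHom.map_adjugate, ← RingHom.map_adjugate]
    exact h3
  have hu : IsUnit p.det := (Matrix.isUnit_iff_isUnit_det p).1 hp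
  have hP : IsUnit P.val.det := (Matrix.isUnit_iff_isUnit_det P.val).1 P.isUnit
  have h4 := (hdet.inv (Ring.mul_inverse_cancel _ hu) hP.ne_zero).mul hadj
  rw [Matrix.coe_units_inv, Matrix.inv_def, Matrix.inv_def]
  simpa using h4

/-- Evaluation of differential polynomials is compatible with values, if the derivations are. -/
theorem HasValue.evalD {δ δ' : Fin m → Derivation ℤ F F} {v : ι → F}
    {D : Fin m → Derivation ℤ (FunField d S) (FunField d S)}
    (hD : ∀ i f a, HasValue f δ v a → HasValue (D i f) δ v (δ' i a)) {κ : Type*}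
    {w : κ → FunField d S} {y : κ → F} (hw : ∀ k, HasValue (w k) δ v (y k))
    (p : DPoly (constants d) m κ) : HasValue (evalD D w p) δ v (evalD δ' y p) := by
  -- In the product ring with componentwise derivations the graph of evaluation is a differential
  -- subring, so it contains `p` evaluated at the pairs `(w k, y k)`.
  let E : Fin m → Der (FunField d S × F) := fun i => prodD (D i) (δ' i)
  have h := evalD_mem_subring (Γ := valueGraph d S δ v) (D := E) (R := constants d)
    (z := fun k => (w k, y k)) (fun c => hasValue_constant δ v c)
    (fun i x hx => hD i x.1 x.2 hx) hw p
  have h1 := map_evalD (D := E) (D' := D) (R := constants d) (RingHom.fst (FunField d S) F)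
    (fun c => rfl) (fun i x => rfl) (fun k => (w k, y k)) p
  have h2 := map_evalD (D := E) (D' := δ') (R := constants d) (RingHom.snd (FunField d S) F)
    (fun c => rfl) (fun i x => rfl) (fun k => (w k, y k)) p
  change HasValue (RingHom.fst (FunField d S) F _) δ v (RingHom.snd (FunField d S) F _) at h
  rw [h1, h2] at h
  exact h

end Values

/-! ### Regular functions -/

section Regular

variable {X : Type*} (δ : X → Fin m → Derivation ℤ F F) (z : X → ι → F)

variable (d) in
/-- The functions that are given by a quotient of differential polynomials with constant
coefficients near `x₀`. -/
def regularAt (x₀ : X) : Subring (X → F) where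
  carrier := {φ | ∃ R S : DPoly (constants d) m ι, evalD (δ x₀) (z x₀) S ≠ 0 ∧
    ∀ x, evalD (δ x) (z x) S ≠ 0 → φ x * evalD (δ x) (z x) S = evalD (δ x) (z x) R}
  one_mem' := ⟨1, 1, by simp, by simp⟩
  zero_mem' := ⟨0, 1, by simp, by simp⟩
  mul_mem' := by
    rintro φ ψ ⟨R, S, h, hs⟩ ⟨R', S', h', hs'⟩
    refine ⟨R * R', S * S', by simp [h, h'], fun x hx => ?_⟩
    rw [map_mul] at hx
    rw [map_mul, map_mul, ← hs x (left_ne_zero_of_mul hx), ← hs' x (right_ne_zero_of_mul hx),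
      Pi.mul_apply]
    ring
  add_mem' := by
    rintro φ ψ ⟨R, S, h, hs⟩ ⟨R', S', h', hs'⟩
    refine ⟨R * S' + R' * S, S * S', by simp [h, h'], fun x hx => ?_⟩
    rw [map_mul] at hx
    rw [map_mul, map_add, map_mul, map_mul, ← hs x (left_ne_zero_of_mul hx),
      ← hs' x (right_ne_zero_of_mul hx), Pi.add_apply]
    ring
  neg_mem' := by
    rintro φ ⟨R, S, h, hs⟩
    exact ⟨-R, S, h, fun x hx => by rw [map_neg, ← hs x hx, Pi.neg_apply, neg_mul]⟩

variable {δ z}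

theorem evalD_mem_regularAt (x₀ : X) (p : DPoly (constants d) m ι) :
    (fun x => evalD (δ x) (z x) p) ∈ regularAt d δ z x₀ :=
  ⟨p, 1, by simp, by simp⟩

theorem inv_mem_regularAt {x₀ : X} {φ : X → F} (hφ : φ ∈ regularAt d δ z x₀) (h0 : φ x₀ ≠ 0) :
    φ⁻¹ ∈ regularAt d δ z x₀ := by
  obtain ⟨R, S, h, hs⟩ := hφ
  -- The extra factor `S` confines the identity to points where `φ = R/S` is known to hold.
  refine ⟨S * S, R * S, ?_, fun x hx => ?_⟩
  · rw [map_mul, ← hs x₀ h]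
    exact mul_ne_zero (mul_ne_zero h0 h) h
  · rw [map_mul] at hx
    have hS := right_ne_zero_of_mul hx
    have hR := left_ne_zero_of_mul hx
    rw [← hs x hS] at hR
    rw [map_mul, map_mul, ← hs x hS, Pi.inv_apply, mul_assoc (φ x),
      inv_mul_cancel_left₀ (left_ne_zero_of_mul hR)]

/-- Each value `φ x` is an element of `F`, so `δ x i` can be applied to the relation `φ S = R` at
the single point `x`, wherever `S` does not vanish. -/
theorem derivation_mem_regularAt (hd : Commuting d) (hδ : ∀ x, δ x ∈ base d) {x₀ : X}
    {φ : X → F} (hφ : φ ∈ regularAt d δ z x₀) (i : Fin m) :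
    (fun x => δ x i (φ x)) ∈ regularAt d δ z x₀ := by
  obtain ⟨R, S, h, hs⟩ := hφ
  refine ⟨formalD _ ι i R * S - R * formalD _ ι i S, S * S, by simp [h], fun x hx => ?_⟩
  rw [map_mul] at hx
  have hS := left_ne_zero_of_mul hx
  have hδc := commuting_of_mem_base hd (hδ x)
  have hcc := fun (c : constants d) j => base_const (hδ x) c j
  have h2 := congrArg (δ x i) (hs x hS)
  rw [Derivation.leibniz, smul_eq_mul, smul_eq_mul, ← evalD_formalD hδc hcc,
    ← evalD_formalD hδc hcc] at h2
  rw [map_sub, map_mul, map_mul, map_mul, ← h2, ← hs x hS]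
  ring

theorem matrix_inv_mem_regularAt {x₀ : X} {κ : Type*} [Fintype κ] [DecidableEq κ]
    {M : X → GL κ F} (hM : ∀ i j, (fun x => M x i j) ∈ regularAt d δ z x₀) (i j : κ) :
    (fun x => ((M x)⁻¹ : GL κ F) i j) ∈ regularAt d δ z x₀ := by
  let N : Matrix κ κ (X → F) := Matrix.of fun i j x => M x i j
  have hN : ∀ x, (Pi.evalRingHom (fun _ : X => F) x).mapMatrix N = (M x).val := fun x => rfl
  have hdet : (fun x => (M x).val.det) ∈ regularAt d δ z x₀ := by
    have h : (fun x => (M x).val.det) = N.det := by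
      funext x
      rw [← hN, ← RingHom.map_det]
      rfl
    rw [h]
    exact det_mem_subring hM
  have hadj : (fun x => (M x).val.adjugate i j) ∈ regularAt d δ z x₀ := by
    have h : (fun x => (M x).val.adjugate i j) = N.adjugate i j := by
      funext x
      rw [← hN, ← RingHom.map_adjugate]
      rfl
    rw [h]
    exact adjugate_mem_subring hM i j
  have hu : (M x₀).val.det ≠ 0 :=
    ((Matrix.isUnit_iff_isUnit_det _).1 (M x₀).isUnit).ne_zero
  refine cast (congrArg (· ∈ regularAt d δ z x₀) ?_)
    ((regularAt d δ z x₀).mul_mem (inv_mem_regularAt hdet hu) hadj)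
  funext x
  rw [Matrix.coe_units_inv, Matrix.inv_def]
  simp

theorem exists_ne_zero_of_mem_regularAt {x₀ : X} {φ : X → F} (hφ : φ ∈ regularAt d δ z x₀)
    (h0 : φ x₀ ≠ 0) : ∃ R : DPoly (constants d) m ι, evalD (δ x₀) (z x₀) R ≠ 0 ∧
      ∀ x, evalD (δ x) (z x) R ≠ 0 → φ x ≠ 0 := by
  obtain ⟨R, S, h, hs⟩ := hφ
  refine ⟨R * S, ?_, fun x hx h => ?_⟩
  · rw [map_mul, ← hs x₀ h]
    exact mul_ne_zero (mul_ne_zero h0 h) h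
  · rw [map_mul] at hx
    have h2 := hs x (right_ne_zero_of_mul hx)
    rw [h, zero_mul] at h2
    exact left_ne_zero_of_mul hx h2.symm

end Regular

/-! ### Generic arrows -/

section Generic

variable {n l : ℕ}

/-- The unknowns `h i j` and `y k` that parametrize `GL(n, F) × GL^δ(m, F)` by
`(h, y) ↦ (h, δ y)`. -/
abbrev GroupIdx (n m : ℕ) : Type := (Fin n × Fin n) ⊕ Fin m

/-- The generic matrix `h`. -/
def genericLeft (R : Type*) [CommRing R] (n m : ℕ) :
    Matrix (Fin n) (Fin n) (DPoly R m (GroupIdx n m)) :=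
  Matrix.of fun i j => MvPolynomial.X (Sum.inl (i, j), 0)

/-- The Jacobian matrix `δ y` of the generic vector `y`. -/
def genericRight (R : Type*) [CommRing R] (n m : ℕ) :
    Matrix (Fin m) (Fin m) (DPoly R m (GroupIdx n m)) :=
  Matrix.of fun i k => MvPolynomial.X (Sum.inr k, Pi.single i 1)

/-- The Jacobian matrix `δ y`. -/
def jacobian (δ : Fin m → Derivation ℤ F F) (y : Fin m → F) : Matrix (Fin m) (Fin m) F :=
  Matrix.of fun i k => δ i (y k)

/-- A point of `GroupIdx`. -/
def groupPoint (h : Matrix (Fin n) (Fin n) F) (y : Fin m → F) : GroupIdx n m → F :=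
  Sum.elim (fun ij => h ij.1 ij.2) y

theorem map_triple {A B : Type*} (φ : A → B) (h : Matrix (Fin n) (Fin n) A)
    (g : Matrix (Fin m) (Fin m) A) (v : Fin l → A) :
    (fun k => φ (triple h g v k)) = triple (h.map φ) (g.map φ) (fun k => φ (v k)) := by
  funext k
  rcases k with k | k | k <;> rfl

theorem genericLeft_evalD (δ : Fin m → Derivation ℤ F F) (h : Matrix (Fin n) (Fin n) F)
    (y : Fin m → F) : (genericLeft F n m).map (evalD δ (groupPoint h y)) = h := by
  ext i j
  simp [genericLeft, jetOp_zero, groupPoint]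

theorem genericRight_evalD {δ : Fin m → Derivation ℤ F F} (hδ : Commuting δ)
    (h : Matrix (Fin n) (Fin n) F) (y : Fin m → F) :
    (genericRight F n m).map (evalD δ (groupPoint h y)) = jacobian δ y := by
  ext i j
  simp [genericRight, jetOp_single hδ, groupPoint, jacobian]

/-- The restriction of a differential polynomial to the generic point `(h, δ y, x)`. -/
def restrictGeneric {C R : Type*} [CommRing C] [CommRing R] [Algebra C R]
    (δ : Fin m → Derivation ℤ R R) (x : Fin l → R) (p : DPoly C m (TripleIdx n m l)) :
    DPoly R m (GroupIdx n m) :=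
  evalD (extD δ (GroupIdx n m))
    (triple (genericLeft R n m) (genericRight R n m) fun k => MvPolynomial.C (x k)) p

/-- Restricting at the generic `x` and then specializing is restricting at the special point. Hence
the coefficients of a restriction are differential polynomials in the point. -/
theorem map_restrictGeneric {C R R' : Type*} [CommRing C] [CommRing R] [CommRing R']
    [Algebra C R] [Algebra C R'] {δ : Fin m → Derivation ℤ R R}
    {δ' : Fin m → Derivation ℤ R' R'} (ψ : R →+* R')
    (hC : ∀ c : C, ψ (algebraMap C R c) = algebraMap C R' c)
    (hψ : ∀ i a, ψ (δ i a) = δ' i (ψ a)) (x : Fin l → R) (p : DPoly C m (TripleIdx n m l)) :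
    MvPolynomial.map ψ (restrictGeneric δ x p) = restrictGeneric δ' (fun k => ψ (x k)) p := by
  have h := map_evalD (D := extD δ (GroupIdx n m)) (D' := extD δ' (GroupIdx n m))
    (MvPolynomial.map ψ) (R := C) (fun c => by
      rw [IsScalarTower.algebraMap_apply C R, MvPolynomial.algebraMap_eq, MvPolynomial.map_C, hC,
        IsScalarTower.algebraMap_apply C R' (DPoly R' m (GroupIdx n m)),
        MvPolynomial.algebraMap_eq])
    (fun i a => map_extD ψ hψ i a)
    (triple (genericLeft R n m) (genericRight R n m) fun k => MvPolynomial.C (x k)) p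
  rw [restrictGeneric, h, restrictGeneric, map_triple]
  congr 2
  · congr 1
    · ext1 i j
      simp [genericLeft]
    · ext1 i j
      simp [genericRight]
    · simp

theorem evalD_restrictGeneric {C : Type*} [CommRing C] [Algebra C F]
    {δ : Fin m → Derivation ℤ F F} (hδ : Commuting δ) (h : Matrix (Fin n) (Fin n) F)
    (y : Fin m → F) (v : Fin l → F) (p : DPoly C m (TripleIdx n m l)) :
    evalD δ (groupPoint h y) (restrictGeneric δ v p) =
      evalD δ (triple h (jacobian δ y) v) p := by
  have h2 := map_evalD (D := extD δ (GroupIdx n m)) (D' := δ) (R := C)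
    ((evalD (R := F) δ (groupPoint h y) : DPoly F m (GroupIdx n m) →ₐ[F] F) :
      DPoly F m (GroupIdx n m) →+* F) (fun c => by
      rw [IsScalarTower.algebraMap_apply C F]
      exact AlgHom.commutes (evalD (R := F) δ (groupPoint h y)) _)
    (fun i a => evalD_extD hδ (fun _ _ => rfl) _ i a)
    (triple (genericLeft F n m) (genericRight F n m) fun k => MvPolynomial.C (v k)) p
  rw [map_triple] at h2
  simp only [RingHom.coe_coe, genericLeft_evalD, genericRight_evalD hδ, evalD_C] at h2
  exact h2

/-- Membership in `intGL` says that every column of `g` is a closed covector; its potentials form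
the vector `y`. -/
theorem exists_jacobian_eq {δ : Fin m → Derivation ℤ F F} (hδ : Commuting δ)
    (hF : IsDiffClosed δ) {g : GL (Fin m) F} (hg : g ∈ intGL δ) :
    ∃ y, jacobian δ y = g.val := by
  choose y hy using fun k => hF.exists_potential hδ (c := fun i => g i k)
    fun i j => hg i j k
  exact ⟨y, Matrix.ext fun i k => hy k i⟩

theorem restrictGeneric_ne_zero {C : Type*} [CommRing C] [Algebra C F]
    {δ : Fin m → Derivation ℤ F F} (hδ : Commuting δ) (hF : IsDiffClosed δ)
    {h : GL (Fin n) F} {g : GL (Fin m) F} (hg : g ∈ intGL δ) {v : Fin l → F}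
    {p : DPoly C m (TripleIdx n m l)} (hp : evalD δ (triple h.val g.val v) p ≠ 0) :
    restrictGeneric δ v p ≠ 0 := by
  intro h0
  obtain ⟨y, hy⟩ := exists_jacobian_eq hδ hF hg
  rw [← hy, ← evalD_restrictGeneric hδ, h0, map_zero] at hp
  exact hp rfl

/-- A nonzero differential polynomial in `(h, y)` does not vanish at some `(h, y)` with `h` and
`δ y` invertible. -/
theorem exists_group_point {δ : Fin m → Derivation ℤ F F} (hδ : Commuting δ)
    (hF : IsDiffClosed δ) {q : DPoly F m (GroupIdx n m)} (hq : q ≠ 0) :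
    ∃ (h : GL (Fin n) F) (g : GL (Fin m) F) (y : Fin m → F), g ∈ intGL δ ∧
      g.val = jacobian δ y ∧ evalD δ (groupPoint h.val y) q ≠ 0 := by
  have hl : ∀ h y, evalD δ (groupPoint h y) (genericLeft F n m).det = h.det := fun h y => by
    rw [AlgHom.map_det, AlgHom.mapMatrix_apply, genericLeft_evalD]
  have hr : ∀ (h : Matrix (Fin n) (Fin n) F) y,
      evalD δ (groupPoint h y) (genericRight F n m).det = (jacobian δ y).det := fun h y => by
    rw [AlgHom.map_det, AlgHom.mapMatrix_apply, genericRight_evalD hδ]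
  obtain ⟨y₁, hy₁⟩ := exists_jacobian_eq hδ hF (one_mem_intGL δ)
  have hl0 : (genericLeft F n m).det ≠ 0 := fun h0 => by
    have := hl 1 0
    rw [h0] at this
    simp at this
  have hr0 : (genericRight F n m).det ≠ 0 := fun h0 => by
    have := hr 1 y₁
    rw [h0, hy₁] at this
    simp at this
  -- Multiplying `q` by both determinants forces the nonzero into the group; `δ y` is then
  -- integrable because the `δ i` commute.
  obtain ⟨x, hx⟩ := hF.exists_evalD_ne_zero hδ (mul_ne_zero (mul_ne_zero hq hl0) hr0)
  obtain ⟨h, y, rfl⟩ : ∃ h y, x = groupPoint h y :=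
    ⟨Matrix.of fun i j => x (Sum.inl (i, j)), fun k => x (Sum.inr k), by
      funext k
      rcases k with k | k <;> rfl⟩
  rw [map_mul, map_mul, hl, hr] at hx
  refine ⟨Matrix.GeneralLinearGroup.mkOfDetNeZero h
    (right_ne_zero_of_mul (left_ne_zero_of_mul hx)),
    Matrix.GeneralLinearGroup.mkOfDetNeZero (jacobian δ y) (right_ne_zero_of_mul hx), y, ?_, rfl,
    left_ne_zero_of_mul (left_ne_zero_of_mul hx)⟩
  intro i j k
  exact hδ i j (y k)

theorem isOpen_evalD_ne_zero (δ : Fin m → Derivation ℤ F F) (p : DPoly F m ι) :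
    @IsOpen _ (kolchin δ ι) {z | evalD δ z p ≠ 0} := by
  change {z | evalD δ z p ≠ 0}ᶜ ∈ Set.range _
  refine ⟨{p}, ?_⟩
  ext z
  simp [zeros]

/-- The fibres of `GL(n, F) × GL^δ(m, F) × W` are irreducible, and arrows that start in a given
dense subset are dense. -/
theorem exists_generic_arrow {δ : Fin m → Derivation ℤ F F} (hδ : Commuting δ)
    (hF : IsDiffClosed δ) {C : Type*} [CommRing C] [Algebra C F] {W W₀ : Set (Fin l → F)}
    (hW : @IsIrreducible _ (kolchin δ (Fin l)) W)
    (hW₀ : W ⊆ @closure _ (kolchin δ (Fin l)) W₀)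
    {p q : DPoly C m (TripleIdx n m l)} {h₁ h₂ : GL (Fin n) F} {g₁ g₂ : GL (Fin m) F}
    {v₁ v₂ : Fin l → F} (hg₁ : g₁ ∈ intGL δ) (hg₂ : g₂ ∈ intGL δ) (hv₁ : v₁ ∈ W) (hv₂ : v₂ ∈ W)
    (hp : evalD δ (triple h₁.val g₁.val v₁) p ≠ 0)
    (hq : evalD δ (triple h₂.val g₂.val v₂) q ≠ 0) :
    ∃ (h : GL (Fin n) F) (g : GL (Fin m) F), g ∈ intGL δ ∧ ∃ v ∈ W₀,
      evalD δ (triple h.val g.val v) p ≠ 0 ∧ evalD δ (triple h.val g.val v) q ≠ 0 := by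
  -- With `v₁` and `v₂` fixed, `p` and `q` become nonzero polynomials in the free unknowns `(h, y)`,
  -- hence have a common nonzero `(h, g)`.
  obtain ⟨h, g, y, hg, hgy, hy⟩ := exists_group_point hδ hF
    (mul_ne_zero (restrictGeneric_ne_zero hδ hF hg₁ hp) (restrictGeneric_ne_zero hδ hF hg₂ hq))
  rw [map_mul, evalD_restrictGeneric hδ, evalD_restrictGeneric hδ, ← hgy] at hy
  -- Now `(h, g)` is fixed and the point varies: irreducibility of `W` joins the nonzeros `v₁` and
  -- `v₂`, and density moves the result into `W₀`.
  have hpoly : ∀ p : DPoly C m (TripleIdx n m l), ∃ p' : DPoly F m (Fin l),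
      ∀ v, evalD δ v p' = evalD δ (triple h.val g.val v) p := by
    intro p
    refine ⟨evalD (extD δ (Fin l)) (triple (h.val.map MvPolynomial.C) (g.val.map MvPolynomial.C)
      fun k => MvPolynomial.X (k, 0)) p, fun v => ?_⟩
    have h2 := map_evalD (D := extD δ (Fin l)) (D' := δ) (R := C)
      ((evalD (R := F) δ v : DPoly F m (Fin l) →ₐ[F] F) : DPoly F m (Fin l) →+* F) (fun c => by
        rw [IsScalarTower.algebraMap_apply C F]
        exact AlgHom.commutes (evalD (R := F) δ v) _)
      (fun i a => evalD_extD hδ (fun _ _ => rfl) _ i a)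
      (triple (h.val.map MvPolynomial.C) (g.val.map MvPolynomial.C)
        fun k => MvPolynomial.X (k, 0)) p
    rw [map_triple] at h2
    refine h2.trans ?_
    congr 2
    congr 1
    · ext1 i j
      simp
    · ext1 i j
      simp
    · funext k
      simp [jetOp_zero]
  obtain ⟨p', hp'⟩ := hpoly p
  obtain ⟨q', hq'⟩ := hpoly q
  let := kolchin δ (Fin l)
  obtain ⟨v, hvW, hv⟩ := hW.2 {v | evalD δ v p' ≠ 0} {v | evalD δ v q' ≠ 0}
    (isOpen_evalD_ne_zero δ p') (isOpen_evalD_ne_zero δ q')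
    ⟨v₁, hv₁, by
      rw [Set.mem_ofPred_eq, hp']
      exact left_ne_zero_of_mul hy⟩ ⟨v₂, hv₂, by
      rw [Set.mem_ofPred_eq, hq']
      exact right_ne_zero_of_mul hy⟩
  obtain ⟨u, ⟨hu₁, hu₂⟩, hu⟩ := mem_closure_iff.1 (hW₀ hvW) _
    ((isOpen_evalD_ne_zero δ p').inter (isOpen_evalD_ne_zero δ q')) hv
  exact ⟨h, g, hg, u, hu, by rw [← hp']; exact hu₁, by rw [← hq']; exact hu₂⟩

end Generic

end Field

end DiffInv

namespace DiffInv

variable {F : Type u} [Field F] {m n l : ℕ}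

/-! ### Fractions and commuting derivations on `C⟨S⟩`. -/

theorem exists_toFun_eq {d : Fin m → Derivation ℤ F F} {ι : Type*}
    {S : (Fin m → Derivation ℤ F F) → Set (ι → F)} (f : FunField d S) :
    ∃ r s, f * toFun d S s = toFun d S r ∧ IsUnit (toFun d S s) := by
  obtain ⟨⟨r, s⟩, h⟩ := IsLocalization.surj (nonZeroDivisors (CoordRing d S)) f
  obtain ⟨r, rfl⟩ := toCoord_surjective d S r
  obtain ⟨s', hs'⟩ := toCoord_surjective d S s
  refine ⟨r, s', ?_, ?_⟩
  · rw [toFun, hs']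
    exact h
  · rw [toFun, hs']
    exact IsLocalization.map_units _ s

theorem formalD_eq_extD {R : Type*} [CommRing R] {ι : Type*} (i : Fin m) (p : DPoly R m ι) :
    formalD R ι i p = extD (0 : Fin m → Derivation ℤ R R) ι i p := by
  let E : Der (DPoly R m ι) := (formalD R ι i).restrictScalars ℤ
  have hE : ∀ q, E q = formalD R ι i q := fun q => rfl
  have h := derivation_eq_zero_of_generators
    (E - extD (0 : Fin m → Derivation ℤ R R) ι i)
    (fun a => by simp [hE, formalD, extD_C])
    (fun s => by simp [hE, formalD, extD_X, MvPolynomial.mkDerivation_X]) p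
  exact sub_eq_zero.1 h

theorem commuting_funD {d : Fin m → Derivation ℤ F F} (hd : Commuting d) {ι : Type*}
    (S : (Fin m → Derivation ℤ F F) → Set (ι → F)) : Commuting (funD hd S) := by
  refine commuting_fracD (D := coordD hd S) fun i j a => ?_
  obtain ⟨p, rfl⟩ := toCoord_surjective d S a
  simp only [coordD, quotD_apply, formalD_eq_extD]
  rw [commuting_extD (fun _ _ _ => rfl) ι i j p]

/-! ### Arrows of the groupoid -/

/-- An arrow of the groupoid together with a point of the fibre of `W` over its source. -/
structure Arrow (d : Fin m → Derivation ℤ F F) (n : ℕ)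
    (W : (Fin m → Derivation ℤ F F) → Set (Fin l → F)) where
  /-- the source -/
  src : Fin m → Derivation ℤ F F
  src_mem : src ∈ base d
  /-- the component in `GL(n, F)` -/
  left : GL (Fin n) F
  /-- the component in `GL^δ(m, F)` -/
  right : GL (Fin m) F
  right_mem : right ∈ intGL src
  /-- the point over the source -/
  pt : Fin l → F
  pt_mem : pt ∈ W src

namespace Arrow

variable {d : Fin m → Derivation ℤ F F} {W : (Fin m → Derivation ℤ F F) → Set (Fin l → F)}

/-- The target of an arrow. -/
def tgt (x : Arrow d n W) : Fin m → Derivation ℤ F F := act x.right x.src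

/-- The components of an arrow. -/
def coords (x : Arrow d n W) : TripleIdx n m l → F := triple x.left.val x.right.val x.pt

theorem tgt_mem (x : Arrow d n W) : x.tgt ∈ base d := act_mem_base x.src_mem x.right_mem

theorem coords_mem (x : Arrow d n W) : x.coords ∈ diamond n W x.src :=
  ⟨x.left, x.right, x.pt, x.right_mem, x.pt_mem, rfl⟩

/-- The functions on the arrows that are locally quotients of differential polynomials. -/
abbrev regular (x : Arrow d n W) : Subring (Arrow d n W → F) :=
  regularAt d Arrow.src Arrow.coords x

theorem pt_regular (x₀ : Arrow d n W) (p : DPoly (constants d) m (Fin l)) :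
    (fun x => evalD x.src x.pt p) ∈ x₀.regular := by
  have h := evalD_mem_regularAt (d := d) (δ := Arrow.src) (z := Arrow.coords) x₀
    (renameD (Sum.inr ∘ Sum.inr) p)
  simp only [evalD_renameD] at h
  exact h

end Arrow

/-- An algebraic representation `τ` of the groupoid on `W` with an equivariant map `P` to the
groups, defined on an invariant dense subfamily `W₀`. -/
structure IsEquivariant (d : Fin m → Derivation ℤ F F)
    (W : (Fin m → Derivation ℤ F F) → Set (Fin l → F))
    (τ : (Fin m → Derivation ℤ F F) → GL (Fin n) F → GL (Fin m) F → (Fin l → F) → (Fin l → F))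
    (T : Fin l → FunField d (diamond n W))
    (W₀ : (Fin m → Derivation ℤ F F) → Set (Fin l → F))
    (P₀ : (Fin m → Derivation ℤ F F) → (Fin l → F) → GL (Fin n) F)
    (P₁ : (Fin m → Derivation ℤ F F) → (Fin l → F) → GL (Fin m) F)
    (p₀ : Matrix (Fin n) (Fin n) (FunField d W))
    (p₁ : Matrix (Fin m) (Fin m) (FunField d W)) : Prop where
  comm : Commuting d
  closed : IsDiffClosed d
  irred : ∀ δ ∈ base d, @IsIrreducible _ (kolchin δ (Fin l)) (W δ)
  hT : ∀ δ ∈ base d, ∀ (h : GL (Fin n) F), ∀ g ∈ intGL δ, ∀ v ∈ W δ, ∀ k,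
    HasValue (T k) δ (triple h.val g.val v) (τ δ h g v k)
  hτW : ∀ δ ∈ base d, ∀ (h : GL (Fin n) F), ∀ g ∈ intGL δ, ∀ v ∈ W δ, τ δ h g v ∈ W (act g δ)
  hτone : ∀ δ ∈ base d, ∀ v ∈ W δ, τ δ 1 1 v = v
  hτmul : ∀ δ ∈ base d, ∀ (h h₁ : GL (Fin n) F), ∀ g ∈ intGL δ, ∀ g₁ ∈ intGL (act g δ),
    ∀ v ∈ W δ, τ (act g δ) h₁ g₁ (τ δ h g v) = τ δ (h * h₁) (g * g₁) v
  sub : ∀ δ ∈ base d, W₀ δ ⊆ W δ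
  dense : ∀ δ ∈ base d, W δ ⊆ @closure _ (kolchin δ (Fin l)) (W₀ δ)
  inv : ∀ δ ∈ base d, ∀ (h : GL (Fin n) F), ∀ g ∈ intGL δ, ∀ v ∈ W₀ δ,
    τ δ h g v ∈ W₀ (act g δ)
  hp₀ : ∀ δ ∈ base d, ∀ v ∈ W₀ δ, ∀ i j, HasValue (p₀ i j) δ v (P₀ δ v i j)
  hp₁ : ∀ δ ∈ base d, ∀ v ∈ W₀ δ, ∀ i j, HasValue (p₁ i j) δ v (P₁ δ v i j)
  hP₁ : ∀ δ ∈ base d, ∀ v ∈ W₀ δ, P₁ δ v ∈ intGL δ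
  hP : ∀ δ ∈ base d, ∀ (h : GL (Fin n) F), ∀ g ∈ intGL δ, ∀ v ∈ W₀ δ,
    P₀ (act g δ) (τ δ h g v) = h⁻¹ * P₀ δ v ∧ P₁ (act g δ) (τ δ h g v) = g⁻¹ * P₁ δ v

namespace IsEquivariant

variable {d : Fin m → Derivation ℤ F F} {W : (Fin m → Derivation ℤ F F) → Set (Fin l → F)}
  {τ : (Fin m → Derivation ℤ F F) → GL (Fin n) F → GL (Fin m) F → (Fin l → F) → (Fin l → F)}
  {T : Fin l → FunField d (diamond n W)}
  {W₀ : (Fin m → Derivation ℤ F F) → Set (Fin l → F)}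
  {P₀ : (Fin m → Derivation ℤ F F) → (Fin l → F) → GL (Fin n) F}
  {P₁ : (Fin m → Derivation ℤ F F) → (Fin l → F) → GL (Fin m) F}
  {p₀ : Matrix (Fin n) (Fin n) (FunField d W)} {p₁ : Matrix (Fin m) (Fin m) (FunField d W)}

section

variable (H : IsEquivariant d W τ T W₀ P₀ P₁ p₀ p₁)
include H

/-! ### Regularity of the action and irreducibility of the family `W`. -/

/-- The functions `q⟨τ⟩` are regular. -/
theorem tau_regular (x₀ : Arrow d n W) (q : DPoly (constants d) m (Fin l)) :
    (fun x : Arrow d n W => evalD x.tgt (τ x.src x.left x.right x.pt) q) ∈ x₀.regular := by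
  have hright : ∀ i j, (fun x : Arrow d n W => x.right i j) ∈ x₀.regular := fun i j => by
    have h := evalD_mem_regularAt (d := d) (δ := Arrow.src) (z := Arrow.coords) x₀
      (MvPolynomial.X (Sum.inr (Sum.inl (i, j)), 0))
    simp only [evalD_X, jetOp_zero] at h
    exact h
  -- The fraction that represents `T k` at `x₀` computes `τ` wherever its denominator is nonzero, by
  -- uniqueness of values.
  have hcomp : ∀ k, (fun x : Arrow d n W => τ x.src x.left x.right x.pt k) ∈ x₀.regular := by
    intro k
    obtain ⟨r, s, h, hs, -⟩ := H.hT x₀.src x₀.src_mem x₀.left x₀.right x₀.right_mem x₀.pt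
      x₀.pt_mem k
    refine ⟨r, s, hs.ne_zero, fun x hx => ?_⟩
    have h1 := H.hT x.src x.src_mem x.left x.right x.right_mem x.pt x.pt_mem k
    have h2 : HasValue (T k) x.src x.coords (evalD x.src x.coords r / evalD x.src x.coords s) :=
      ⟨r, s, h, isUnit_iff_ne_zero.2 hx, div_mul_cancel₀ _ hx⟩
    dsimp only
    rw [h1.unique x.src_mem x.coords_mem h2, div_mul_cancel₀ _ hx]
  -- At the target the derivations are `g⁻¹δ`, a combination of the source derivations with regular
  -- coefficients.
  have hder : ∀ i (a : Arrow d n W → F), a ∈ x₀.regular →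
      (fun x => x.tgt i (a x)) ∈ x₀.regular := by
    intro i a ha
    refine cast (congrArg (· ∈ x₀.regular) ?_) (x₀.regular.sum_mem (t := Finset.univ)
      (f := fun j x => (x.right⁻¹ : GL (Fin m) F) i j * x.src j (a x)) fun j _ =>
        x₀.regular.mul_mem (matrix_inv_mem_regularAt hright i j)
          (derivation_mem_regularAt H.comm Arrow.src_mem ha j))
    funext x
    rw [Finset.sum_apply, Arrow.tgt, act, combo_apply]
  induction q using MvPolynomial.induction_on with
  | C c =>
    simp only [evalD_C]
    have h := evalD_mem_regularAt (d := d) (δ := Arrow.src) (z := Arrow.coords) x₀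
      (MvPolynomial.C c)
    simp only [evalD_C] at h
    exact h
  | add p q hp hq =>
    simp only [map_add]
    exact x₀.regular.add_mem hp hq
  | mul_X p kα hp =>
    simp only [map_mul, evalD_X]
    exact x₀.regular.mul_mem hp (jetOp_induction (fun x : Arrow d n W => x.tgt)
      (fun a => a ∈ x₀.regular) hder kα.2 (fun x => τ x.src x.left x.right x.pt kα.1)
      (hcomp kα.1))

/-- Two regular functions that do not vanish identically on the arrows with a given source have a
common nonzero at an arrow that starts in `W₀`. -/
theorem exists_arrow {φ ψ : Arrow d n W → F} {x y : Arrow d n W} (hφ : φ ∈ x.regular)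
    (hψ : ψ ∈ y.regular) (hxy : x.src = y.src) (hx : φ x ≠ 0) (hy : ψ y ≠ 0) :
    ∃ z : Arrow d n W, z.src = x.src ∧ z.pt ∈ W₀ z.src ∧ φ z ≠ 0 ∧ ψ z ≠ 0 := by
  obtain ⟨p, hp, hpφ⟩ := exists_ne_zero_of_mem_regularAt hφ hx
  obtain ⟨q, hq, hqψ⟩ := exists_ne_zero_of_mem_regularAt hψ hy
  obtain ⟨δ, hδ, h₁, g₁, hg₁, v₁, hv₁⟩ := x
  obtain ⟨δ', hδ', h₂, g₂, hg₂, v₂, hv₂⟩ := y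
  obtain rfl : δ = δ' := hxy
  obtain ⟨h, g, hg, v, hv, hp', hq'⟩ := exists_generic_arrow
    (commuting_of_mem_base H.comm hδ) (isDiffClosed_of_mem_base H.comm H.closed hδ)
    (H.irred δ hδ) (H.dense δ hδ) hg₁ hg₂ hv₁ hv₂ hp hq
  exact ⟨⟨δ, hδ, h, g, hg, v, H.sub δ hδ hv⟩, rfl, hv, hpφ _ hp', hqψ _ hq'⟩

/-- The arrow that inverts `(h, g)`. -/
theorem tau_inv {δ : Fin m → Derivation ℤ F F} (hδ : δ ∈ base d) (h : GL (Fin n) F)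
    {g : GL (Fin m) F} (hg : g ∈ intGL δ) {v : Fin l → F} (hv : v ∈ W δ) :
    τ (act g δ) h⁻¹ g⁻¹ (τ δ h g v) = v := by
  rw [H.hτmul δ hδ h h⁻¹ g hg g⁻¹ (inv_mem_intGL hg) v hv, mul_inv_cancel, mul_inv_cancel,
    H.hτone δ hδ v hv]

/-- Each point is the end of an arrow with a given source. -/
theorem exists_arrow_to {δ δ₁ : Fin m → Derivation ℤ F F} (hδ : δ ∈ base d)
    (hδ₁ : δ₁ ∈ base d) {v : Fin l → F} (hv : v ∈ W δ₁) : ∃ x : Arrow d n W, x.src = δ ∧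
      x.tgt = δ₁ ∧ τ x.src x.left x.right x.pt = v := by
  obtain ⟨g, hg, rfl⟩ := exists_act_eq hδ₁ hδ
  have hback : act g⁻¹ (act g δ₁) = δ₁ := by rw [act_act, mul_inv_cancel, act_one]
  -- This is the inverse of the arrow `(1, g)` from `v`; `1⁻¹` is kept to match `tau_inv`.
  refine ⟨⟨act g δ₁, hδ, 1⁻¹, g⁻¹, inv_mem_intGL hg, τ δ₁ 1 g v, H.hτW δ₁ hδ₁ 1 g hg v hv⟩,
    rfl, hback, H.tau_inv hδ₁ 1 hg hv⟩

/-- Irreducibility is given fibre by fibre, while the ideal involves all fibres. Pulling back along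
`τ` to the arrows with source `d` reduces to one fibre: there two functions `p⟨τ⟩` and `q⟨τ⟩`, each
nonzero somewhere, have a common nonzero. -/
theorem isPrime_vanishingIdeal : (vanishingIdeal d W).IsPrime := by
  constructor
  · rw [Ideal.ne_top_iff_one]
    intro h
    obtain ⟨v, hv⟩ := (H.irred d (self_mem_base d)).1
    have := h d (self_mem_base d) v hv
    simp at this
  · intro p q hpq
    by_contra! hc
    obtain ⟨hp, hq⟩ := hc
    have hne : ∀ p, p ∉ vanishingIdeal d W → ∃ x : Arrow d n W, x.src = d ∧
        evalD x.tgt (τ x.src x.left x.right x.pt) p ≠ 0 := by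
      intro p hp
      have hp' : ¬ ∀ δ ∈ base d, ∀ z ∈ W δ, evalD δ z p = 0 := hp
      push Not at hp'
      obtain ⟨δ, hδ, z, hz, h⟩ := hp'
      obtain ⟨x, hx, rfl, rfl⟩ := H.exists_arrow_to (self_mem_base d) hδ hz
      exact ⟨x, hx, h⟩
    obtain ⟨x, hx, hxp⟩ := hne p hp
    obtain ⟨y, hy, hyq⟩ := hne q hq
    obtain ⟨z, -, -, hzp, hzq⟩ := H.exists_arrow (H.tau_regular x p) (H.tau_regular y q)
      (hx.trans hy.symm) hxp hyq
    have h := hpq z.tgt z.tgt_mem _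
      (H.hτW z.src z.src_mem z.left z.right z.right_mem z.pt z.pt_mem)
    rw [map_mul] at h
    exact mul_ne_zero hzp hzq h

theorem isField : IsField (FunField d W) := by
  have := H.isPrime_vanishingIdeal
  have : IsDomain (CoordRing d W) :=
    inferInstanceAs (IsDomain (DPoly (constants d) m (Fin l) ⧸ vanishingIdeal d W))
  exact Field.toIsField (FractionRing (CoordRing d W))

theorem isUnit_of_ne_zero {f : FunField d W} (hf : f ≠ 0) : IsUnit f := by
  obtain ⟨g, hg⟩ := H.isField.mul_inv_cancel hf
  exact IsUnit.of_mul_eq_one g hg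

/-- A differential rational function that vanishes wherever it is defined on `W₀` is zero. -/
theorem eq_zero_of_values {f : FunField d W}
    (hf : ∀ δ ∈ base d, ∀ v ∈ W₀ δ, ∀ a, HasValue f δ v a → a = 0) : f = 0 := by
  obtain ⟨r, s, h, hs⟩ := exists_toFun_eq f
  have h0 : toFun d W (r * s) = 0 := by
    rw [toFun_eq_zero]
    intro δ hδ z hz
    by_contra hc
    -- The point `z` is carried by a unit arrow, so that `exists_arrow` moves the inequation from
    -- `z` into `W₀`.
    let x : Arrow d n W := ⟨δ, hδ, 1, 1, one_mem_intGL δ, z, hz⟩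
    obtain ⟨y, -, hy₀, hy, -⟩ := H.exists_arrow (x := x) (y := x) (x.pt_regular (r * s))
      (x.pt_regular (r * s)) rfl hc hc
    rw [map_mul] at hy
    have hs := right_ne_zero_of_mul hy
    have h2 := hf y.src y.src_mem y.pt hy₀ (evalD y.src y.pt r / evalD y.src y.pt s)
      ⟨r, s, h, isUnit_iff_ne_zero.2 hs, div_mul_cancel₀ _ hs⟩
    exact div_ne_zero (left_ne_zero_of_mul hy) hs h2
  rw [toFun_mul, ← h, mul_assoc] at h0
  exact (hs.mul hs).mul_left_eq_zero.1 h0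

theorem ne_zero_of_hasValue {f : FunField d W} {δ : Fin m → Derivation ℤ F F}
    (hδ : δ ∈ base d) {v : Fin l → F} (hv : v ∈ W₀ δ) {a : F} (ha : HasValue f δ v a)
    (h0 : a ≠ 0) : f ≠ 0 := by
  rintro rfl
  exact h0 (ha.unique hδ (H.sub δ hδ hv) (valueGraph d W δ v).zero_mem)

/-! ### The normalized derivations `P₁⟨x⟩⁻¹∂`. -/

theorem nonempty_W₀ {δ : Fin m → Derivation ℤ F F} (hδ : δ ∈ base d) : (W₀ δ).Nonempty := by
  let := kolchin δ (Fin l)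
  obtain ⟨v, hv⟩ := (H.irred δ hδ).1
  exact closure_nonempty_iff.1 ⟨v, H.dense δ hδ hv⟩

theorem isUnit_p₁ : IsUnit p₁ := by
  rw [Matrix.isUnit_iff_isUnit_det]
  obtain ⟨v, hv⟩ := H.nonempty_W₀ (self_mem_base d)
  exact H.isUnit_of_ne_zero (H.ne_zero_of_hasValue (self_mem_base d) hv
    (HasValue.det (H.hp₁ d (self_mem_base d) v hv))
    ((Matrix.isUnit_iff_isUnit_det _).1 (P₁ d v).isUnit).ne_zero)

/-- At `(δ, v)` the normalized derivations act as the system at the target of the arrow `P⟨v⟩`. -/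
theorem hasValue_combo (hd : Commuting d) {δ : Fin m → Derivation ℤ F F} (hδ : δ ∈ base d)
    {v : Fin l → F} (hv : v ∈ W₀ δ) (i : Fin m) {f : FunField d W} {a : F}
    (ha : HasValue f δ v a) :
    HasValue (combo p₁⁻¹ (funD hd W) i f) δ v (act (P₁ δ v) δ i a) := by
  rw [combo_apply, act, combo_apply]
  exact HasValue.sum _ fun j => (HasValue.matrix_inv H.isUnit_p₁ (H.hp₁ δ hδ v hv) i j).mul
    (ha.derivation hd hδ j)

/-- The matrix `p₁` is integrable over the differential field `C⟨W⟩`, because all its values on `W₀`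
are; so `commuting_act` applies to `C⟨W⟩` itself. -/
theorem commuting_combo (hd : Commuting d) : Commuting (combo p₁⁻¹ (funD hd W)) := by
  let := H.isField.toField
  obtain ⟨g, hg⟩ := H.isUnit_p₁
  have hint : g ∈ intGL (funD hd W) := by
    intro i j k
    rw [hg, ← sub_eq_zero]
    refine H.eq_zero_of_values fun δ hδ v hv a ha => ?_
    refine (ha.unique hδ (H.sub δ hδ hv) (((H.hp₁ δ hδ v hv j k).derivation hd hδ i).sub
      ((H.hp₁ δ hδ v hv i k).derivation hd hδ j))).trans ?_
    rw [H.hP₁ δ hδ v hv i j k, sub_self]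
  have h := commuting_act (commuting_funD hd W) hint
  rw [act, Matrix.coe_units_inv, hg] at h
  exact h

/-! ### The generators -/

/-- Different points may need different fractions for `T k`. One of them defines `w k`, and the
others give its values where the denominator of that one vanishes. -/
theorem exists_generators (hd : Commuting d) : ∃ w : Fin l → FunField d W,
    (∀ k, HasValue (T k) (funD hd W) (triple p₀ p₁ (coord d W)) (w k)) ∧
    ∀ δ ∈ base d, ∀ v ∈ W₀ δ, ∀ k,
      HasValue (w k) δ v (τ δ (P₀ δ v) (P₁ δ v) v k) := by
  have hval : ∀ δ ∈ base d, ∀ v ∈ W₀ δ, ∀ p : DPoly (constants d) m (TripleIdx n m l),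
      HasValue (evalD (funD hd W) (triple p₀ p₁ (coord d W)) p) δ v
        (evalD δ (triple (P₀ δ v).val (P₁ δ v).val v) p) := by
    intro δ hδ v hv p
    refine HasValue.evalD (fun i f a ha => ha.derivation hd hδ i) ?_ p
    rintro (k | k | k)
    · exact H.hp₀ δ hδ v hv _ _
    · exact H.hp₁ δ hδ v hv _ _
    · have h := hasValue_toFun (d := d) (S := W) δ v (MvPolynomial.X (k, 0))
      rw [evalD_X, jetOp_zero] at h
      exact h
  -- The substitution `(h, g, v) ↦ (P⟨x⟩, x)` is well defined modulo the ideal of the arrows: over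
  -- `W₀` the substituted points are arrows.
  have hgen : ∀ p q : DPoly (constants d) m (TripleIdx n m l),
      toFun d (diamond n W) p = toFun d (diamond n W) q →
      evalD (funD hd W) (triple p₀ p₁ (coord d W)) p =
        evalD (funD hd W) (triple p₀ p₁ (coord d W)) q := by
    intro p q hpq
    rw [← sub_eq_zero]
    refine H.eq_zero_of_values fun δ hδ v hv a ha => ?_
    refine (ha.unique hδ (H.sub δ hδ hv)
      ((hval δ hδ v hv p).sub (hval δ hδ v hv q))).trans ?_
    rw [evalD_eq_of_toFun_eq hpq hδ
      ⟨P₀ δ v, P₁ δ v, v, H.hP₁ δ hδ v hv, H.sub δ hδ hv, rfl⟩, sub_self]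
  have hTv : ∀ δ ∈ base d, ∀ v ∈ W₀ δ, ∀ k, HasValue (T k) δ
      (triple (P₀ δ v).val (P₁ δ v).val v) (τ δ (P₀ δ v) (P₁ δ v) v k) :=
    fun δ hδ v hv k => H.hT δ hδ _ _ (H.hP₁ δ hδ v hv) v (H.sub δ hδ hv) k
  have hd0 := self_mem_base d
  obtain ⟨v₀, hv₀⟩ := H.nonempty_W₀ hd0
  choose r s hrs hs _ using hTv d hd0 v₀ hv₀
  have hu : ∀ k, IsUnit (evalD (funD hd W) (triple p₀ p₁ (coord d W)) (s k)) := fun k =>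
    H.isUnit_of_ne_zero (H.ne_zero_of_hasValue hd0 hv₀ (hval d hd0 v₀ hv₀ (s k)) (hs k).ne_zero)
  choose e he using fun k => (hu k).exists_right_inv
  refine ⟨fun k => e k * evalD (funD hd W) (triple p₀ p₁ (coord d W)) (r k),
    fun k => ⟨r k, s k, hrs k, hu k, ?_⟩, fun δ hδ v hv k => ?_⟩
  · linear_combination (evalD (funD hd W) (triple p₀ p₁ (coord d W)) (r k)) * he k
  -- The local fraction `r'/s'` at `v` represents the same element `w k` after substitution, by
  -- `hgen` applied to `r s' = r' s`.
  · obtain ⟨r', s', hrs', hs', ha⟩ := hTv δ hδ v hv k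
    have h1 : toFun d (diamond n W) (r k * s') = toFun d (diamond n W) (r' * s k) := by
      rw [toFun_mul, toFun_mul, ← hrs k, ← hrs']
      ring
    have h2 := hgen _ _ h1
    rw [map_mul, map_mul] at h2
    rw [eq_div_of_mul_eq hs'.ne_zero ha]
    refine HasValue.of_mul ?_ (hval δ hδ v hv s') hs'.ne_zero (hval δ hδ v hv r')
    linear_combination (e k) * h2 + (evalD (funD hd W) (triple p₀ p₁ (coord d W)) r') * he k

end

end IsEquivariant

end DiffInv

namespace DiffInv

variable {F : Type u} [Field F] {m n l : ℕ}

/-! ### Differential field extensions generated by a set -/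

theorem mem_diffFieldAdjoin {R K : Type*} [CommRing R] [CommRing K] [Algebra R K]
    {D : Fin m → Derivation ℤ K K} {X : Set K} {f : K} :
    f ∈ diffFieldAdjoin R D X ↔ ∀ L : Subalgebra R K, X ⊆ L → (∀ i, ∀ a ∈ L, D i a ∈ L) →
      (∀ a ∈ L, ∀ b, a * b = 1 → b ∈ L) → f ∈ L := by
  rw [diffFieldAdjoin, Algebra.mem_sInf]
  exact ⟨fun h L h1 h2 h3 => h L ⟨h1, h2, h3⟩, fun h L hL => h L hL.1 hL.2.1 hL.2.2⟩

theorem derivation_mem_diffFieldAdjoin {R K : Type*} [CommRing R] [CommRing K] [Algebra R K]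
    {D : Fin m → Derivation ℤ K K} {X : Set K} {f : K} (hf : f ∈ diffFieldAdjoin R D X)
    (i : Fin m) : D i f ∈ diffFieldAdjoin R D X :=
  mem_diffFieldAdjoin.2 fun L h1 h2 h3 => h2 i _ (mem_diffFieldAdjoin.1 hf L h1 h2 h3)

/-- The elements of `diffFieldAdjoin` are the quotients of differential polynomials in the
generators. -/
theorem mem_diffFieldAdjoin_range {R K : Type*} [CommRing R] [CommRing K] [Algebra R K]
    (hK : IsField K) {D : Fin m → Derivation ℤ K K} (hD : Commuting D)
    (hc : ∀ (c : R) i, D i (algebraMap R K c) = 0) {κ : Type*} {w : κ → K} {f : K} :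
    f ∈ diffFieldAdjoin R D (Set.range w) ↔
      ∃ r s : DPoly R m κ, evalD D w s ≠ 0 ∧ f * evalD D w s = evalD D w r := by
  have := hK.isDomain
  constructor
  · intro hf
    let L : Subalgebra R K :=
      { carrier := {f | ∃ r s : DPoly R m κ, evalD D w s ≠ 0 ∧ f * evalD D w s = evalD D w r}
        mul_mem' := by
          rintro f g ⟨r, s, hs, h⟩ ⟨r', s', hs', h'⟩
          refine ⟨r * r', s * s', ?_, ?_⟩
          · rw [map_mul]
            exact mul_ne_zero hs hs'
          · rw [map_mul, map_mul, ← h, ← h']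
            ring
        add_mem' := by
          rintro f g ⟨r, s, hs, h⟩ ⟨r', s', hs', h'⟩
          refine ⟨r * s' + r' * s, s * s', ?_, ?_⟩
          · rw [map_mul]
            exact mul_ne_zero hs hs'
          · rw [map_mul, map_add, map_mul, map_mul, ← h, ← h']
            ring
        algebraMap_mem' := fun c =>
          ⟨MvPolynomial.C c, 1, by rw [map_one]; exact one_ne_zero, by
            rw [map_one, mul_one, evalD_C]⟩ }
    refine mem_diffFieldAdjoin.1 hf L ?_ ?_ ?_
    · rintro _ ⟨k, rfl⟩
      exact ⟨MvPolynomial.X (k, 0), 1, by rw [map_one]; exact one_ne_zero, by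
        rw [map_one, mul_one, evalD_X, jetOp_zero]⟩
    · rintro i f ⟨r, s, hs, h⟩
      refine ⟨formalD R κ i r * s - r * formalD R κ i s, s * s, ?_, ?_⟩
      · rw [map_mul]
        exact mul_ne_zero hs hs
      · have h2 := congrArg (D i) h
        rw [Derivation.leibniz, smul_eq_mul, smul_eq_mul] at h2
        rw [map_sub, map_mul, map_mul, map_mul, evalD_formalD hD hc, evalD_formalD hD hc, ← h2,
          ← h]
        ring
    · rintro f ⟨r, s, hs, h⟩ g hfg
      refine ⟨s, r, fun h0 => ?_, ?_⟩
      · rw [h0] at h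
        exact mul_ne_zero (left_ne_zero_of_mul (hfg.trans_ne one_ne_zero)) hs h
      · rw [← h]
        linear_combination (evalD D w s) * hfg
  · rintro ⟨r, s, hs, h⟩
    refine mem_diffFieldAdjoin.2 fun L h1 h2 h3 => ?_
    have hmem : ∀ p : DPoly R m κ, evalD D w p ∈ L := fun p =>
      evalD_mem_subring (Γ := L.toSubring) (fun c => L.algebraMap_mem c) h2
        (fun k => h1 ⟨k, rfl⟩) p
    obtain ⟨e, he⟩ := hK.mul_inv_cancel hs
    have hf : f = evalD D w r * e := by
      rw [← h, mul_assoc, he, mul_one]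
    rw [hf]
    exact L.mul_mem (hmem r) (h3 _ (hmem s) e he)

namespace IsEquivariant

variable {d : Fin m → Derivation ℤ F F} {W : (Fin m → Derivation ℤ F F) → Set (Fin l → F)}
  {τ : (Fin m → Derivation ℤ F F) → GL (Fin n) F → GL (Fin m) F → (Fin l → F) → (Fin l → F)}
  {T : Fin l → FunField d (diamond n W)}
  {W₀ : (Fin m → Derivation ℤ F F) → Set (Fin l → F)}
  {P₀ : (Fin m → Derivation ℤ F F) → (Fin l → F) → GL (Fin n) F}
  {P₁ : (Fin m → Derivation ℤ F F) → (Fin l → F) → GL (Fin m) F}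
  {p₀ : Matrix (Fin n) (Fin n) (FunField d W)} {p₁ : Matrix (Fin m) (Fin m) (FunField d W)}

section

variable (H : IsEquivariant d W τ T W₀ P₀ P₁ p₀ p₁)
include H

/-! ### Invariants and quotients of differential polynomials in the generators. -/

/-- The moving frame of the end of an arrow: both the normalized system of derivations and the
normalized point are constant along the orbits. -/
theorem slice_eq {δ : Fin m → Derivation ℤ F F} (hδ : δ ∈ base d) (h : GL (Fin n) F)
    {g : GL (Fin m) F} (hg : g ∈ intGL δ) {v : Fin l → F} (hv : v ∈ W₀ δ) :
    act (P₁ (act g δ) (τ δ h g v)) (act g δ) = act (P₁ δ v) δ ∧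
      τ (act g δ) (P₀ (act g δ) (τ δ h g v)) (P₁ (act g δ) (τ δ h g v)) (τ δ h g v) =
        τ δ (P₀ δ v) (P₁ δ v) v := by
  obtain ⟨h0, h1⟩ := H.hP δ hδ h g hg v hv
  have hmem := H.hP₁ (act g δ) (act_mem_base hδ hg) _ (H.inv δ hδ h g hg v hv)
  constructor
  · rw [h1, act_act, mul_inv_cancel_left]
  · rw [H.hτmul δ hδ h _ g hg _ hmem v (H.sub δ hδ hv), h0, h1, mul_inv_cancel_left,
      mul_inv_cancel_left]

variable {w : Fin l → FunField d W}
  (hw : ∀ δ ∈ base d, ∀ v ∈ W₀ δ, ∀ k, HasValue (w k) δ v (τ δ (P₀ δ v) (P₁ δ v) v k))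
include hw

/-- The value is that of `p` at the normal form of `(δ, v)`; by `slice_eq` it is constant along
orbits. -/
theorem hasValue_evalD_generators (hd : Commuting d) {δ : Fin m → Derivation ℤ F F}
    (hδ : δ ∈ base d) {v : Fin l → F} (hv : v ∈ W₀ δ) (p : DPoly (constants d) m (Fin l)) :
    HasValue (evalD (combo p₁⁻¹ (funD hd W)) w p) δ v
      (evalD (act (P₁ δ v) δ) (τ δ (P₀ δ v) (P₁ δ v) v) p) :=
  HasValue.evalD (fun i _ _ ha => H.hasValue_combo hd hδ hv i ha) (hw δ hδ v hv) p

/-- Quotients of differential polynomials in the generators are invariant. -/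
theorem mem_invariants (hd : Commuting d) {f : FunField d W}
    {p q : DPoly (constants d) m (Fin l)}
    (hq : evalD (combo p₁⁻¹ (funD hd W)) w q ≠ 0)
    (hf : f * evalD (combo p₁⁻¹ (funD hd W)) w q = evalD (combo p₁⁻¹ (funD hd W)) w p) :
    f ∈ invariants W τ := by
  intro δ hδ h g hg v hv a b ha hb
  have hval := fun {δ} hδ {v} hv p =>
    H.hasValue_evalD_generators hw hd (δ := δ) hδ (v := v) hv p
  -- A nonzero of the denominator is needed over this very source `δ`. Any point of `W₀` can be
  -- moved there by an arrow, and its normal form does not change.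
  obtain ⟨u, hu, hu0⟩ : ∃ u ∈ W₀ δ,
      evalD (act (P₁ δ u) δ) (τ δ (P₀ δ u) (P₁ δ u) u) q ≠ 0 := by
    by_contra! hc
    refine hq (H.eq_zero_of_values fun δ₁ hδ₁ v₁ hv₁ a ha => ?_)
    rw [ha.unique hδ₁ (H.sub δ₁ hδ₁ hv₁) (hval hδ₁ hv₁ q)]
    obtain ⟨γ, hγ, rfl⟩ := exists_act_eq hδ₁ hδ
    obtain ⟨h1, h2⟩ := H.slice_eq hδ₁ 1 hγ hv₁
    rw [← h1, ← h2]
    exact hc _ (H.inv δ₁ hδ₁ 1 γ hγ v₁ hv₁)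
  -- At points of `W₀`, `r₀ ≠ 0` forces the value of the denominator to be nonzero, since that value
  -- times `s₀` is `r₀`.
  obtain ⟨r₀, s₀, h₀, hs₀, hu₀⟩ := hval hδ hu q
  obtain ⟨r, s, hrs, hs, har⟩ := ha
  obtain ⟨r', s', hrs', hs', hbr⟩ := hb
  by_contra hne
  -- The first factor measures the failure of invariance; the second keeps both denominators
  -- nonzero. If `b ≠ a`, then `φ` is nonzero at the given arrow, hence at one starting in `W₀`,
  -- where constancy of the normal form excludes it.
  let φ : Arrow d n W → F := fun x =>
    (evalD x.tgt (τ x.src x.left x.right x.pt) r' * evalD x.src x.pt s -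
      evalD x.src x.pt r * evalD x.tgt (τ x.src x.left x.right x.pt) s') *
    (evalD x.src x.pt s * evalD x.tgt (τ x.src x.left x.right x.pt) s')
  have hφ : ∀ x : Arrow d n W, φ ∈ x.regular := fun x =>
    x.regular.mul_mem (x.regular.sub_mem (x.regular.mul_mem (H.tau_regular x r')
      (x.pt_regular s)) (x.regular.mul_mem (x.pt_regular r) (H.tau_regular x s')))
      (x.regular.mul_mem (x.pt_regular s) (H.tau_regular x s'))
  let x₁ : Arrow d n W := ⟨δ, hδ, h, g, hg, v, hv⟩
  let x₂ : Arrow d n W := ⟨δ, hδ, 1, 1, one_mem_intGL δ, u, H.sub δ hδ hu⟩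
  have h1 : φ x₁ ≠ 0 := by
    have h2 : φ x₁ = (b - a) * (evalD δ v s * evalD (act g δ) (τ δ h g v) s') *
        (evalD δ v s * evalD (act g δ) (τ δ h g v) s') := by
      simp only [φ, x₁, Arrow.tgt]
      rw [← har, ← hbr]
      ring
    rw [h2]
    have h3 := mul_ne_zero hs.ne_zero hs'.ne_zero
    exact mul_ne_zero (mul_ne_zero (sub_ne_zero.2 hne) h3) h3
  have h2 : evalD x₂.src x₂.pt r₀ ≠ 0 := by
    rw [← hu₀]
    exact mul_ne_zero hu0 hs₀.ne_zero
  obtain ⟨x, -, hx₀, hx1, hx2⟩ := H.exists_arrow (hφ x₁) (x₂.pt_regular r₀) rfl h1 h2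
  have hsx : evalD x.src x.pt s ≠ 0 := left_ne_zero_of_mul (right_ne_zero_of_mul hx1)
  have hsx' : evalD x.tgt (τ x.src x.left x.right x.pt) s' ≠ 0 :=
    right_ne_zero_of_mul (right_ne_zero_of_mul hx1)
  obtain ⟨e1, e2⟩ := H.slice_eq x.src_mem x.left x.right_mem hx₀
  have hW := H.inv x.src x.src_mem x.left x.right x.right_mem x.pt hx₀
  have hq1 := hval x.src_mem hx₀ q
  have hp1 := hval x.src_mem hx₀ p
  have hq2 := hval x.tgt_mem hW q
  have hp2 := hval x.tgt_mem hW p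
  have hf1 : HasValue f x.src x.pt (evalD x.src x.pt r / evalD x.src x.pt s) :=
    ⟨r, s, hrs, isUnit_iff_ne_zero.2 hsx, div_mul_cancel₀ _ hsx⟩
  have hf2 : HasValue f x.tgt (τ x.src x.left x.right x.pt)
      (evalD x.tgt (τ x.src x.left x.right x.pt) r' /
        evalD x.tgt (τ x.src x.left x.right x.pt) s') :=
    ⟨r', s', hrs', isUnit_iff_ne_zero.2 hsx', div_mul_cancel₀ _ hsx'⟩
  have k1 := (hf1.mul hq1).unique x.src_mem (H.sub _ x.src_mem hx₀) (by rw [hf]; exact hp1)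
  have k2 := (hf2.mul hq2).unique x.tgt_mem (H.sub _ x.tgt_mem hW) (by rw [hf]; exact hp2)
  rw [Arrow.tgt] at k2
  rw [e1, e2, ← k1] at k2
  have hq0 : evalD (act (P₁ x.src x.pt) x.src)
      (τ x.src (P₀ x.src x.pt) (P₁ x.src x.pt) x.pt) q ≠ 0 := by
    intro h0
    have k3 := (hq1.mul (hasValue_toFun x.src x.pt s₀)).unique x.src_mem
      (H.sub _ x.src_mem hx₀) (by rw [h₀]; exact hasValue_toFun x.src x.pt r₀)
    rw [h0, zero_mul] at k3
    exact hx2 k3.symm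
  have k4 := mul_right_cancel₀ hq0 k2
  have k5 := (div_eq_div_iff hsx' hsx).1 k4
  exact left_ne_zero_of_mul hx1 (sub_eq_zero.2 k5)

/-- Invariants are quotients of differential polynomials in the generators. -/
theorem exists_of_mem_invariants (hd : Commuting d) {f : FunField d W}
    (hf : f ∈ invariants W τ) : ∃ p q : DPoly (constants d) m (Fin l),
      evalD (combo p₁⁻¹ (funD hd W)) w q ≠ 0 ∧
      f * evalD (combo p₁⁻¹ (funD hd W)) w q = evalD (combo p₁⁻¹ (funD hd W)) w p := by
  have := H.isField.isDomain
  have hval := fun {δ} hδ {v} hv p =>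
    H.hasValue_evalD_generators hw hd (δ := δ) hδ (v := v) hv p
  obtain ⟨r, s, hrs, hs⟩ := exists_toFun_eq f
  obtain ⟨δ₀, hδ₀, v₀, hv₀, hs₀⟩ : ∃ δ ∈ base d, ∃ v ∈ W₀ δ, evalD δ v s ≠ 0 := by
    by_contra! hc
    refine hs.ne_zero (H.eq_zero_of_values fun δ hδ v hv a ha => ?_)
    rw [ha.unique hδ (H.sub δ hδ hv) (hasValue_toFun δ v s)]
    exact hc δ hδ v hv
  have hg₀ := H.hP₁ δ₀ hδ₀ v₀ hv₀
  -- The arrow from the normal form back to `v₀`, at whose end `s` does not vanish.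
  let x₀ : Arrow d n W := ⟨act (P₁ δ₀ v₀) δ₀, act_mem_base hδ₀ hg₀, (P₀ δ₀ v₀)⁻¹,
    (P₁ δ₀ v₀)⁻¹, inv_mem_intGL hg₀, τ δ₀ (P₀ δ₀ v₀) (P₁ δ₀ v₀) v₀,
    H.hτW δ₀ hδ₀ _ _ hg₀ v₀ (H.sub δ₀ hδ₀ hv₀)⟩
  let ψr : Arrow d n W → F := fun x => evalD x.tgt (τ x.src x.left x.right x.pt) r
  let ψs : Arrow d n W → F := fun x => evalD x.tgt (τ x.src x.left x.right x.pt) s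
  have hψs : ψs x₀ ≠ 0 := by
    have h1 : x₀.tgt = δ₀ := by
      change act (P₁ δ₀ v₀)⁻¹ (act (P₁ δ₀ v₀) δ₀) = δ₀
      rw [act_act, mul_inv_cancel, act_one]
    have h2 : τ x₀.src x₀.left x₀.right x₀.pt = v₀ :=
      H.tau_inv hδ₀ _ hg₀ (H.sub δ₀ hδ₀ hv₀)
    simp only [ψs]
    rwa [h1, h2]
  obtain ⟨Q, hQ, hQψ⟩ := exists_ne_zero_of_mem_regularAt (H.tau_regular x₀ s) hψs
  obtain ⟨R₁, S₁, hS₁, hRS⟩ := x₀.regular.mul_mem (H.tau_regular x₀ r)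
    (inv_mem_regularAt (H.tau_regular x₀ s) hψs)
  -- the quotient `r⟨τ⟩ / s⟨τ⟩` equals `R / S` near the arrow `x₀`
  obtain ⟨R, S, hS, hRS⟩ : ∃ R S : DPoly (constants d) m (TripleIdx n m l),
      evalD x₀.src x₀.coords S ≠ 0 ∧ ∀ x : Arrow d n W, evalD x.src x.coords S ≠ 0 →
        ψs x ≠ 0 ∧ ψr x * evalD x.src x.coords S = evalD x.src x.coords R * ψs x := by
    refine ⟨R₁ * Q, S₁ * Q, by rw [map_mul]; exact mul_ne_zero hS₁ hQ, fun x hx => ?_⟩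
    rw [map_mul] at hx
    have h1 : ψs x ≠ 0 := hQψ x (right_ne_zero_of_mul hx)
    have h2 : ψr x * (ψs x)⁻¹ * evalD x.src x.coords S₁ = evalD x.src x.coords R₁ :=
      hRS x (left_ne_zero_of_mul hx)
    refine ⟨h1, ?_⟩
    rw [map_mul, map_mul, ← h2]
    field_simp
  -- The restriction to the generic arrow with the starting point also generic: its coefficients are
  -- differential polynomials over `C` in that point.
  let gen : DPoly (constants d) m (TripleIdx n m l) →
      DPoly (DPoly (constants d) m (Fin l)) m (GroupIdx n m) :=
    restrictGeneric (extD (0 : Fin m → Der (constants d)) (Fin l))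
      fun k => MvPolynomial.X (k, 0)
  have hgen : ∀ δ ∈ base d, ∀ y : Fin l → F, ∀ p,
      MvPolynomial.map (evalD (R := constants d) δ y).toRingHom (gen p) =
        restrictGeneric δ y p := by
    intro δ hδ y p
    have h := map_restrictGeneric (C := constants d)
      (δ := extD (0 : Fin m → Der (constants d)) (Fin l)) (δ' := δ)
      (evalD (R := constants d) δ y).toRingHom (fun c => AlgHom.commutes (evalD δ y) c)
      (fun i a => evalD_extD (commuting_of_mem_base H.comm hδ)
        (fun i c => by
          rw [Pi.zero_apply, Derivation.zero_apply, map_zero]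
          exact base_const hδ c i) y i a) (fun k => MvPolynomial.X (k, 0)) p
    refine h.trans ?_
    congr 1
    funext k
    exact (evalD_X _ _ _).trans (jetOp_zero _ _)
  have hx₀c := commuting_of_mem_base H.comm x₀.src_mem
  have hne : restrictGeneric x₀.src x₀.pt S ≠ 0 := restrictGeneric_ne_zero hx₀c
    (isDiffClosed_of_mem_base H.comm H.closed x₀.src_mem) x₀.right_mem hS
  -- Any monomial whose coefficient in `S` survives at the normal form of `v₀` will do; this makes
  -- the denominator `E` nonzero in `C⟨W⟩`.
  obtain ⟨μ, hμ⟩ := MvPolynomial.ne_zero_iff.1 hne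
  have hcoeff : ∀ δ ∈ base d, ∀ y : Fin l → F, ∀ p, (restrictGeneric δ y p).coeff μ =
      evalD δ y ((gen p).coeff μ) := by
    intro δ hδ y p
    rw [← hgen δ hδ, MvPolynomial.coeff_map]
    rfl
  rw [hcoeff _ x₀.src_mem] at hμ
  let E := evalD (combo p₁⁻¹ (funD hd W)) w ((gen S).coeff μ)
  let E' := evalD (combo p₁⁻¹ (funD hd W)) w ((gen R).coeff μ)
  have hE : E ≠ 0 := H.ne_zero_of_hasValue hδ₀ hv₀ (hval hδ₀ hv₀ _) hμ
  refine ⟨(gen R).coeff μ, (gen S).coeff μ, hE, ?_⟩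
  -- The factor `E * s` restricts the check to points where neither denominator vanishes.
  have key : (toFun d W r * E - toFun d W s * E') * (E * toFun d W s) = 0 := by
    refine H.eq_zero_of_values fun δ hδ v hv a ha => ?_
    have hg := H.hP₁ δ hδ v hv
    rw [ha.unique hδ (H.sub δ hδ hv) ((((hasValue_toFun δ v r).mul (hval hδ hv _)).sub
      ((hasValue_toFun δ v s).mul (hval hδ hv _))).mul
      ((hval hδ hv _).mul (hasValue_toFun δ v s)))]
    by_cases h0 : evalD (act (P₁ δ v) δ) (τ δ (P₀ δ v) (P₁ δ v) v) ((gen S).coeff μ) *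
        evalD δ v s = 0
    · rw [h0, mul_zero]
    have hsv := right_ne_zero_of_mul h0
    have hδ' : act (P₁ δ v) δ ∈ base d := act_mem_base hδ hg
    set δ' := act (P₁ δ v) δ with hδ'_def
    set y := τ δ (P₀ δ v) (P₁ δ v) v with hy_def
    have hyW : y ∈ W δ' := H.hτW δ hδ _ _ hg v (H.sub δ hδ hv)
    have hδ'c := commuting_of_mem_base H.comm hδ'
    have hSne : restrictGeneric δ' y S ≠ 0 := by
      intro h1
      have h2 := hcoeff δ' hδ' y S
      rw [h1, MvPolynomial.coeff_zero] at h2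
      exact left_ne_zero_of_mul h0 h2.symm
    -- Invariance makes `R/S` equal to the constant `r(v)/s(v)` on the arrows from `y` with `S ≠ 0`.
    -- A nonzero difference would be nonzero at such an arrow.
    have hzero : MvPolynomial.C (evalD δ v r) * restrictGeneric δ' y S -
        MvPolynomial.C (evalD δ v s) * restrictGeneric δ' y R = 0 := by
      by_contra hc
      obtain ⟨h, g, t, hgi, hgt, ht⟩ := exists_group_point hδ'c
        (isDiffClosed_of_mem_base H.comm H.closed hδ') (mul_ne_zero hc hSne)
      rw [map_mul, map_sub, map_mul, map_mul, evalD_C, evalD_C, evalD_restrictGeneric hδ'c,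
        evalD_restrictGeneric hδ'c, ← hgt, Algebra.algebraMap_self_apply,
        Algebra.algebraMap_self_apply] at ht
      let x : Arrow d n W := ⟨δ', hδ', h, g, hgi, y, hyW⟩
      obtain ⟨hx1, hx2⟩ := hRS x (right_ne_zero_of_mul ht)
      -- Following `P⟨v⟩` by `(h, g)` gives one arrow from `v`, to which the invariance of `f`
      -- applies without evaluating `f` at `y`.
      have htau : τ δ' h g y = τ δ (P₀ δ v * h) (P₁ δ v * g) v :=
        H.hτmul δ hδ _ _ _ hg _ hgi v (H.sub δ hδ hv)
      have hact : act g δ' = act (P₁ δ v * g) δ := act_act _ _ _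
      have hinv := hf δ hδ (P₀ δ v * h) (P₁ δ v * g) (mul_mem_intGL hg hgi) v
        (H.sub δ hδ hv) (evalD δ v r / evalD δ v s) (ψr x / ψs x)
        ⟨r, s, hrs, isUnit_iff_ne_zero.2 hsv, div_mul_cancel₀ _ hsv⟩
        ⟨r, s, hrs, by
          rw [← htau, ← hact]
          exact isUnit_iff_ne_zero.2 hx1, by
          rw [← htau, ← hact]
          exact div_mul_cancel₀ _ hx1⟩
      rw [div_eq_div_iff hx1 hsv] at hinv
      refine left_ne_zero_of_mul ht (mul_right_cancel₀ hx1 ?_)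
      change (evalD δ v r * evalD x.src x.coords S - evalD δ v s * evalD x.src x.coords R) *
        ψs x = 0 * ψs x
      linear_combination (-evalD x.src x.coords S) * hinv + evalD δ v s * hx2
    have h3 := congrArg (MvPolynomial.coeff μ) hzero
    rw [MvPolynomial.coeff_sub, MvPolynomial.coeff_C_mul, MvPolynomial.coeff_C_mul,
      hcoeff δ' hδ', hcoeff δ' hδ', MvPolynomial.coeff_zero] at h3
    rw [h3, zero_mul]
  have h1 := (mul_eq_zero.1 key).resolve_right (mul_ne_zero hE hs.ne_zero)
  refine mul_right_cancel₀ hs.ne_zero ?_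
  change f * E * _ = E' * _
  linear_combination E * hrs + h1

end

end IsEquivariant

end DiffInv

end

/-! ### The main theorem. -/

theorem theorem2p4 {F : Type u} [Field F] [CharZero F] {l m n : ℕ}
    -- a differentially closed field whose derivations are linearly independent over `F`
    (d : Fin m → Derivation ℤ F F) (hd : DiffInv.Commuting d)
    (hind : LinearIndependent F d) (hF : DiffInv.IsDiffClosed d)
    -- the family `W` of closed irreducible sets
    (W : (Fin m → Derivation ℤ F F) → Set (Fin l → F))
    (hWclosed : ∀ δ ∈ DiffInv.base d, @IsClosed _ (DiffInv.kolchin δ (Fin l)) (W δ))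
    (hWirred : ∀ δ ∈ DiffInv.base d, @IsIrreducible _ (DiffInv.kolchin δ (Fin l)) (W δ))
    -- the algebraic representation `τ` on `W`; the differential rational functions `T k` are its
    -- components
    (τ : (Fin m → Derivation ℤ F F) → GL (Fin n) F → GL (Fin m) F → (Fin l → F) → (Fin l → F))
    (T : Fin l → DiffInv.FunField d (DiffInv.diamond n W))
    (hT : ∀ δ ∈ DiffInv.base d, ∀ (h : GL (Fin n) F), ∀ g ∈ DiffInv.intGL δ, ∀ v ∈ W δ, ∀ k,
      DiffInv.HasValue (T k) δ (DiffInv.triple h.val g.val v) (τ δ h g v k))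
    (hτW : ∀ δ ∈ DiffInv.base d, ∀ (h : GL (Fin n) F), ∀ g ∈ DiffInv.intGL δ, ∀ v ∈ W δ,
      τ δ h g v ∈ W (DiffInv.act g δ))
    (hτone : ∀ δ ∈ DiffInv.base d, ∀ v ∈ W δ, τ δ 1 1 v = v)
    (hτmul : ∀ δ ∈ DiffInv.base d, ∀ (h h₁ : GL (Fin n) F), ∀ g ∈ DiffInv.intGL δ,
      ∀ g₁ ∈ DiffInv.intGL (DiffInv.act g δ), ∀ v ∈ W δ,
      τ (DiffInv.act g δ) h₁ g₁ (τ δ h g v) = τ δ (h * h₁) (g * g₁) v)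
    -- the invariant dense subfamily `W₀`
    (W₀ : (Fin m → Derivation ℤ F F) → Set (Fin l → F))
    (hW₀W : ∀ δ ∈ DiffInv.base d, W₀ δ ⊆ W δ)
    (hW₀dense : ∀ δ ∈ DiffInv.base d, W δ ⊆ @closure _ (DiffInv.kolchin δ (Fin l)) (W₀ δ))
    (hW₀inv : ∀ δ ∈ DiffInv.base d, ∀ (h : GL (Fin n) F), ∀ g ∈ DiffInv.intGL δ, ∀ v ∈ W₀ δ,
      τ δ h g v ∈ W₀ (DiffInv.act g δ))
    -- the equivariant map `P = (P₀, P₁)` on `W₀`; the entries of `p₀`, `p₁` are its components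
    (P₀ : (Fin m → Derivation ℤ F F) → (Fin l → F) → GL (Fin n) F)
    (P₁ : (Fin m → Derivation ℤ F F) → (Fin l → F) → GL (Fin m) F)
    (p₀ : Matrix (Fin n) (Fin n) (DiffInv.FunField d W))
    (p₁ : Matrix (Fin m) (Fin m) (DiffInv.FunField d W))
    (hp₀ : ∀ δ ∈ DiffInv.base d, ∀ v ∈ W₀ δ, ∀ i j,
      DiffInv.HasValue (p₀ i j) δ v (P₀ δ v i j))
    (hp₁ : ∀ δ ∈ DiffInv.base d, ∀ v ∈ W₀ δ, ∀ i j,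
      DiffInv.HasValue (p₁ i j) δ v (P₁ δ v i j))
    (hP₁ : ∀ δ ∈ DiffInv.base d, ∀ v ∈ W₀ δ, P₁ δ v ∈ DiffInv.intGL δ)
    (hP : ∀ δ ∈ DiffInv.base d, ∀ (h : GL (Fin n) F), ∀ g ∈ DiffInv.intGL δ, ∀ v ∈ W₀ δ,
      P₀ (DiffInv.act g δ) (τ δ h g v) = h⁻¹ * P₀ δ v ∧
      P₁ (DiffInv.act g δ) (τ δ h g v) = g⁻¹ * P₁ δ v) :
    -- `C⟨W⟩` is a field and `P₁⟨x⟩` is invertible over it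
    IsField (DiffInv.FunField d W) ∧ IsUnit p₁ ∧
    -- the members of `δ = P₁⟨x⟩⁻¹ ∂` commute
    DiffInv.Commuting (DiffInv.combo p₁⁻¹ (DiffInv.funD hd W)) ∧
    -- the field of invariants is closed under `δ`
    (∀ i, ∀ f ∈ DiffInv.invariants (d := d) W τ,
      DiffInv.combo p₁⁻¹ (DiffInv.funD hd W) i f ∈ DiffInv.invariants (d := d) W τ) ∧
    -- `w = τ⟨P⟨x⟩; x⟩` is defined and generates it over `C` as a `δ`-differential field
    ∃ w : Fin l → DiffInv.FunField d W,
      (∀ k, DiffInv.HasValue (T k) (DiffInv.funD hd W)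
        (DiffInv.triple p₀ p₁ (DiffInv.coord d W)) (w k)) ∧
      (DiffInv.diffFieldAdjoin (DiffInv.constants d)
        (DiffInv.combo p₁⁻¹ (DiffInv.funD hd W)) (Set.range w) : Set (DiffInv.FunField d W)) =
        DiffInv.invariants (d := d) W τ := by
  have H : DiffInv.IsEquivariant d W τ T W₀ P₀ P₁ p₀ p₁ :=
    ⟨hd, hF, hWirred, hT, hτW, hτone, hτmul, hW₀W, hW₀dense, hW₀inv, hp₀, hp₁, hP₁, hP⟩
  obtain ⟨w, hwT, hw⟩ := H.exists_generators hd
  have hcomm := H.commuting_combo hd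
  have hconst : ∀ (c : DiffInv.constants d) i, DiffInv.combo p₁⁻¹ (DiffInv.funD hd W) i
      (algebraMap (DiffInv.constants d) (DiffInv.FunField d W) c) = 0 := by
    intro c i
    rw [DiffInv.combo_apply]
    refine Finset.sum_eq_zero fun j _ => ?_
    have h := DiffInv.funD_toFun hd W j (MvPolynomial.C c)
    rw [DiffInv.formalD, MvPolynomial.derivation_C, DiffInv.toFun, DiffInv.toFun, map_zero,
      map_zero] at h
    exact (congrArg _ h).trans (mul_zero _)
  have hmem : ∀ f, f ∈ DiffInv.diffFieldAdjoin (DiffInv.constants d)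
      (DiffInv.combo p₁⁻¹ (DiffInv.funD hd W)) (Set.range w) ↔
      f ∈ DiffInv.invariants (d := d) W τ := by
    intro f
    rw [DiffInv.mem_diffFieldAdjoin_range H.isField hcomm hconst]
    exact ⟨fun ⟨p, q, hq, h⟩ => H.mem_invariants hw hd hq h,
      fun h => H.exists_of_mem_invariants hw hd h⟩
  -- Stability of the invariants under `δ` is read off from their equality with the generated
  -- `δ`-field.
  exact ⟨H.isField, H.isUnit_p₁, hcomm,
    fun i f hf => (hmem _).1 (DiffInv.derivation_mem_diffFieldAdjoin ((hmem f).2 hf) i),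
    w, hwT, Set.ext hmem⟩
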